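/- Let $n\ge 2$ and let $m_1,\dots,m_n>0$ be the masses of $n$ particles on the line (dimension $d=1$). Put $$M:=\Big\{q\in\mathbb R^n \;\Big|\; \sum_{i=1}^n m_iq_i=0\Big\},\qquad \langle q,q'\rangle_{\mathcal M}:=\sum_{i=1}^n m_iq_iq'_i,\qquad \Delta:=\{q\in M\mid q_i=q_j\text{ for some } i\ne j\},\qquad \widehat M:=M\setminus\Delta .$$ For a set partition $\mathcal C$ of $\{1,\dots,n\}$ that is not the partition into singletons, let $\Delta^E_{\mathcal C}:=\{q\in M\mid q_i=q_j\text{ whenever } i,j \text{ lie in the same block of }\mathcal C\}$, let $\Delta^I_{\mathcal C}$ be its $\langle\cdot,\cdot\rangle_{\mathcal M}$-orthogonal complement in $M$, write $q=q^E_{\mathcal C}+q^I_{\mathcal C}$ for the corresponding decomposition of $q\in M$, let $S^I_{\mathcal C}$ be the unit sphere of $\Delta^I_{\mathcal C}$ in the norm $\|\cdot\|_{\mathcal M}$, and let $[M:\Delta^E_{\mathcal C}]:=\Delta^E_{\mathcal C}\times[0,\infty)\times S^I_{\mathcal C}$. The graph blow-up of $M$ along $\Delta$ is the closure $$\wideparen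 M_\Delta:=\overline{\hat I_\Delta(\widehat M)}\subseteq\prod_{\mathcal C}[M:\Delta^E_{\mathcal C}],\qquad \hat I_\Delta(q):=\Big(q^E_{\mathcal C},\ \|q^I_{\mathcal C}\|_{\mathcal M},\ \frac{q^I_{\mathcal C}}{\|q^I_{\mathcal C}\|_{\mathcal M}}\Big)_{\mathcal C},$$ an $(n-1)$-dimensional manifold with corners, with the smooth structure inherited from the product. Its boundary $\partial\wideparen M_\Delta$ is the closure in $\wideparen M_\Delta$ of the set of those points that some corner chart, with values in $[0,\infty)^k\times\mathbb R^{n-1-k}$ for some $0\le k\le n-1$, maps to a point of which exactly one of the first $k$ coordinates vanishes. Then $\partial\wideparen M_\Delta$ is homeomorphic to the disjoint union of $n!$ copies of $\mathbb R^{n-2}$. The copies correspond bijectively to the orderings of the particles on the line: the homeomorphism and a bijection of the $n!$ copies with the permutations $\sigma$ of $\{1,\dots,n\}$ can be chosen such that the copy belonging to $\sigma$ consists exactly of the points of $\partial\wideparen M_\Delta$ that lie in the closure of $\hat I_\Delta\big(\{q\in M\mid q_{\sigma(1)}<q_{\sigma(2)}<\dots<q_{\sigma(n)}\}\big)$. 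-/

import Mathlib

open scoped ContDiff Nat

noncomputable section

/-! ### Manifolds with corners inside a normed space -/

namespace Corner

/-- The model space `ℝ^m_k = [0,∞)^k × ℝ^(m-k)`. -/
def model (m k : ℕ) : Set (EuclideanSpace ℝ (Fin m)) :=
  {x | ∀ i : Fin m, (i : ℕ) < k → 0 ≤ x i}

/-- A map on an arbitrary subset `s` of a normed space is smooth if it is the restriction of a
`C^∞` map defined on an open neighbourhood of `s`. -/
def SmoothOn {V W : Type*} [NormedAddCommGroup V] [NormedSpace ℝ V]
    [NormedAddCommGroup W] [NormedSpace ℝ W] (f : V → W) (s : Set V) : Prop :=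
  ∃ (O : Set V) (g : V → W), IsOpen O ∧ s ⊆ O ∧ ContDiffOn ℝ ∞ g O ∧ Set.EqOn g f s

/-- An `m`-dimensional corner chart of a subset `X` of a normed space (with the smooth structure
that `X` inherits from the surrounding space): a diffeomorphism from a relatively open subset
of `X` onto a relatively open subset of some `ℝ^m_k`. -/
structure Chart {V : Type*} [NormedAddCommGroup V] [NormedSpace ℝ V] (X : Set V) (m : ℕ) where
  k : ℕ
  k_le : k ≤ m
  source : Set V
  target : Set (EuclideanSpace ℝ (Fin m))
  toFun : V → EuclideanSpace ℝ (Fin m)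
  invFun : EuclideanSpace ℝ (Fin m) → V
  source_open : ∃ O : Set V, IsOpen O ∧ source = X ∩ O
  target_open : ∃ O : Set (EuclideanSpace ℝ (Fin m)), IsOpen O ∧ target = model m k ∩ O
  mapsTo : Set.MapsTo toFun source target
  mapsTo_inv : Set.MapsTo invFun target source
  leftInv : Set.LeftInvOn invFun toFun source
  rightInv : Set.RightInvOn invFun toFun target
  smooth : SmoothOn toFun source
  smooth_inv : SmoothOn invFun target

/-- `∂_ℓ X`: the points of `X` that some corner chart maps to a point of `ℝ^m_k` of which exactly
`ℓ` of the first `k` coordinates vanish. -/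
def stratum {V : Type*} [NormedAddCommGroup V] [NormedSpace ℝ V] (X : Set V) (m l : ℕ) : Set V :=
  {p | ∃ c : Chart X m, p ∈ c.source ∧
    {i : Fin m | (i : ℕ) < c.k ∧ c.toFun p i = 0}.ncard = l}

/-- The boundary `∂X` of an `m`-dimensional manifold with corners `X`: the closure in `X`
of `∂_1 X`. -/
def boundary {V : Type*} [NormedAddCommGroup V] [NormedSpace ℝ V] (X : Set V) (m : ℕ) : Set V :=
  X ∩ closure (stratum X m 1)

end Corner

/-! ### The configuration space of `n` particles in `E` and its blow-up along collisions

`E` is the Euclidean space in which the particles move, `m i` is the mass of particle `i`. -/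

namespace NBody

variable {n : ℕ} {E : Type*} [NormedAddCommGroup E] [InnerProductSpace ℝ E]

/-- The centre of mass zero configuration space `M`. -/
def configSpace (m : Fin n → ℝ) : Submodule ℝ (Fin n → E) where
  carrier := {q | ∑ i, m i • q i = 0}
  add_mem' {a b} ha hb := by
    simp only [Set.mem_ofPred_eq] at ha hb ⊢
    simp [smul_add, Finset.sum_add_distrib, ha, hb]
  zero_mem' := by simp
  smul_mem' c x hx := by
    simp only [Set.mem_ofPred_eq] at hx ⊢
    simp only [Pi.smul_apply, smul_comm _ c, ← Finset.smul_sum, hx, smul_zero]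

/-- The mass inner product. -/
def massInner (m : Fin n → ℝ) (q q' : Fin n → E) : ℝ :=
  ∑ i, m i * inner ℝ (q i) (q' i)

/-- The collision set `Δ`. -/
def collisionSet (m : Fin n → ℝ) : Set (Fin n → E) :=
  {q | q ∈ configSpace m ∧ ∃ i j, i ≠ j ∧ q i = q j}

/-- The noncollision configuration space `M \ Δ`. -/
def noncollision (m : Fin n → ℝ) : Set (Fin n → E) :=
  {q | q ∈ configSpace m ∧ q ∉ collisionSet m}

/-- Cluster decompositions, that is set partitions, of `{1, …, n}`. -/
abbrev Cluster (n : ℕ) : Type := Finpartition (Finset.univ : Finset (Fin n))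

/-- The cluster decompositions other than the finest one (all of whose atoms are singletons). -/
abbrev CollisionCluster (n : ℕ) : Type := {P : Cluster n // P ≠ ⊥}

/-- The collision subspace `Δ^E_P` of a cluster decomposition: `q i = q j` whenever `i` and `j`
lie in the same atom. -/
def externalSpace (m : Fin n → ℝ) (P : Cluster n) : Set (Fin n → E) :=
  {q | q ∈ configSpace m ∧ ∀ i j, P.part i = P.part j → q i = q j}

/-- The mass-orthogonal complement `Δ^I_P` of the collision subspace. -/
def internalSpace (m : Fin n → ℝ) (P : Cluster n) : Set (Fin n → E) :=
  {q | q ∈ configSpace m ∧ ∀ q' ∈ externalSpace m P, massInner m q q' = 0}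

/-- The cluster projection `q ↦ q^E_P` onto the collision subspace: every particle is moved to the
barycentre of its atom. -/
def externalPart (m : Fin n → ℝ) (P : Cluster n) (q : Fin n → E) : Fin n → E :=
  fun i => (∑ j ∈ P.part i, m j)⁻¹ • ∑ j ∈ P.part i, m j • q j

/-- The internal component `q^I_P = q - q^E_P`. -/
def internalPart (m : Fin n → ℝ) (P : Cluster n) (q : Fin n → E) : Fin n → E :=
  q - externalPart m P q

/-- The radius `r = (J^I_P(q))^(1/2)`, with `J^I_P(q)` the moment of inertia of `q^I_P`. -/
def internalRadius (m : Fin n → ℝ) (P : Cluster n) (q : Fin n → E) : ℝ :=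
  Real.sqrt (massInner m (internalPart m P q) (internalPart m P q))

/-- The vector space `∏_P (E^n × ℝ × E^n)` that contains the product of the blow-ups
`[M : Δ^E_P]`, where `P` runs through the cluster decompositions other than the finest one. -/
abbrev Ambient (n : ℕ) (E : Type*) : Type _ :=
  CollisionCluster n → (Fin n → E) × ℝ × (Fin n → E)

/-- The blow-up `[M : Δ^E_P] = Δ^E_P × [0,∞) × S^I_P` of `M` along `Δ^E_P`, where `S^I_P` is the
unit sphere of `Δ^I_P` in the mass norm. -/
def singleBlowUp (m : Fin n → ℝ) (P : Cluster n) : Set ((Fin n → E) × ℝ × (Fin n → E)) :=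
  {y | y.1 ∈ externalSpace m P ∧ 0 ≤ y.2.1 ∧ y.2.2 ∈ internalSpace m P ∧
    massInner m y.2.2 y.2.2 = 1}

/-- The diagonal map: its component at `P` is `q`, written in the polar coordinates
`(q^E_P, r, q^I_P / r)` of `[M : Δ^E_P]`. -/
def diagonalMap (m : Fin n → ℝ) (q : Fin n → E) : Ambient n E :=
  fun P => (externalPart m P.1 q, internalRadius m P.1 q,
    (internalRadius m P.1 q)⁻¹ • internalPart m P.1 q)

/-- The graph blow-up of `M` along `Δ`: the closure of the image of `M \ Δ` under the
diagonal map. (The product of the `[M : Δ^E_P]` is closed in the surrounding vector space and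
contains that image, so it does not matter in which of the two the closure is taken; see
`diagonalMap_mem` and `isClosed_prod` below.) -/
def graphBlowUp (m : Fin n → ℝ) : Set (Ambient n E) :=
  closure (diagonalMap m '' noncollision m)

/-- The configurations on the line for which the particles are ordered as prescribed by `σ`:
`q_{σ 1} < q_{σ 2} < … < q_{σ n}`. -/
def chamber (m : Fin n → ℝ) (σ : Equiv.Perm (Fin n)) : Set (Fin n → ℝ) :=
  {q | q ∈ configSpace m ∧ StrictMono (fun i => q (σ i))}

/-! ### Consistency of the definitions -/

lemma part_sum_ne_zero {m : Fin n → ℝ} (hm : ∀ i, 0 < m i) (P : Cluster n) (i : Fin n) :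
    (∑ j ∈ P.part i, m j) ≠ 0 :=
  (Finset.sum_pos (fun j _ => hm j) ⟨i, P.mem_part (Finset.mem_univ i)⟩).ne'

/-- Sum over all particles, organised by atoms. -/
lemma sum_internal_eq_zero {m : Fin n → ℝ} (hm : ∀ i, 0 < m i) (P : Cluster n)
    (q : Fin n → E) (C : Finset (Fin n)) (hC : C ∈ P.parts) :
    ∑ i ∈ C, m i • internalPart m P q i = 0 := by
  have hpart : ∀ i ∈ C, P.part i = C := fun i hi => P.part_eq_of_mem hC hi
  obtain ⟨i₀, hi₀⟩ := P.nonempty_of_mem_parts hC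
  have hne : (∑ j ∈ C, m j) ≠ 0 := by
    rw [← hpart i₀ hi₀]
    exact part_sum_ne_zero hm P i₀
  have h1 : ∀ i ∈ C, m i • internalPart m P q i
      = m i • q i - m i • ((∑ j ∈ C, m j)⁻¹ • ∑ j ∈ C, m j • q j) := by
    intro i hi
    simp only [internalPart, externalPart, Pi.sub_apply, hpart i hi, smul_sub]
  rw [Finset.sum_congr rfl h1, Finset.sum_sub_distrib, ← Finset.sum_smul, smul_smul,
    mul_inv_cancel₀ hne, one_smul, sub_self]

lemma sum_parts {F : Type*} [AddCommMonoid F] (P : Cluster n) (f : Fin n → F) :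
    ∑ i, f i = ∑ C ∈ P.parts, ∑ i ∈ C, f i := by
  conv_lhs => rw [← P.biUnion_parts]
  exact Finset.sum_biUnion P.disjoint

lemma internalPart_mem_configSpace {m : Fin n → ℝ} (hm : ∀ i, 0 < m i) (P : Cluster n)
    (q : Fin n → E) : internalPart m P q ∈ configSpace m := by
  change ∑ i, m i • internalPart m P q i = 0
  rw [sum_parts P]
  exact Finset.sum_eq_zero fun C hC => sum_internal_eq_zero hm P q C hC

/-- The external component lies in `Δ^E_P`. -/
lemma externalPart_mem {m : Fin n → ℝ} (hm : ∀ i, 0 < m i) (P : Cluster n)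
    {q : Fin n → E} (hq : q ∈ configSpace m) : externalPart m P q ∈ externalSpace m P := by
  refine ⟨?_, fun i j hij => by simp only [externalPart, hij]⟩
  have h := (configSpace (E := E) m).sub_mem hq (internalPart_mem_configSpace hm P q)
  simpa [internalPart] using h

/-- The internal component lies in `Δ^I_P`; hence `q ↦ q^E_P` is the mass-orthogonal projection
onto `Δ^E_P`. -/
lemma internalPart_mem {m : Fin n → ℝ} (hm : ∀ i, 0 < m i) (P : Cluster n)
    (q : Fin n → E) : internalPart m P q ∈ internalSpace m P := by
  refine ⟨internalPart_mem_configSpace hm P q, fun q' hq' => ?_⟩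
  rw [massInner, sum_parts P]
  refine Finset.sum_eq_zero fun C hC => ?_
  obtain ⟨i₀, hi₀⟩ := P.nonempty_of_mem_parts hC
  have h1 : ∀ i ∈ C, m i * inner ℝ (internalPart m P q i) (q' i)
      = inner ℝ (m i • internalPart m P q i) (q' i₀) := by
    intro i hi
    rw [hq'.2 i i₀ (by rw [P.part_eq_of_mem hC hi, P.part_eq_of_mem hC hi₀]),
      real_inner_smul_left]
  rw [Finset.sum_congr rfl h1, ← sum_inner, sum_internal_eq_zero hm P q C hC, inner_zero_left]

lemma massInner_self_pos {m : Fin n → ℝ} (hm : ∀ i, 0 < m i) {q : Fin n → E} (hq : q ≠ 0) :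
    0 < massInner m q q := by
  obtain ⟨i, hi⟩ := Function.ne_iff.mp hq
  refine Finset.sum_pos' (fun j _ => mul_nonneg (hm j).le real_inner_self_nonneg)
    ⟨i, Finset.mem_univ i, mul_pos (hm i) (real_inner_self_pos.mpr hi)⟩

lemma exists_ne_of_ne_bot {P : Cluster n} (hP : P ≠ ⊥) : ∃ i j, i ≠ j ∧ P.part i = P.part j := by
  by_contra! h
  apply hP
  refine le_bot_iff.mp ?_
  intro C hC
  obtain ⟨i, hi⟩ := P.nonempty_of_mem_parts hC
  refine ⟨{i}, by simp, ?_⟩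
  intro j hj
  by_contra hne
  exact h j i (by simpa using hne) (by rw [P.part_eq_of_mem hC hj, P.part_eq_of_mem hC hi])

/-- The diagonal map takes `M \ Δ` into the product of the blow-ups `[M : Δ^E_P]`. -/
lemma diagonalMap_mem {m : Fin n → ℝ} (hm : ∀ i, 0 < m i) {q : Fin n → E}
    (hq : q ∈ noncollision m) (P : CollisionCluster n) :
    diagonalMap m q P ∈ singleBlowUp m P.1 := by
  obtain ⟨hqM, hqΔ⟩ := hq
  have hint := internalPart_mem hm P.1 q
  have hne : internalPart m P.1 q ≠ 0 := by
    intro h0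
    obtain ⟨i, j, hij, hpart⟩ := exists_ne_of_ne_bot P.2
    refine hqΔ ⟨hqM, i, j, hij, ?_⟩
    have hqe : q = externalPart m P.1 q := sub_eq_zero.mp h0
    rw [hqe]
    exact (externalPart_mem hm P.1 hqM).2 i j hpart
  have hJ := massInner_self_pos hm hne
  refine ⟨externalPart_mem hm P.1 hqM, Real.sqrt_nonneg _,
    ⟨(configSpace m).smul_mem _ hint.1, fun q' hq' => ?_⟩, ?_⟩
  · have := hint.2 q' hq'
    simp only [massInner] at this
    simp only [massInner, diagonalMap, Pi.smul_apply, real_inner_smul_left, mul_left_comm (m _),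
      ← Finset.mul_sum, this, mul_zero]
  · have hr : internalRadius m P.1 q * internalRadius m P.1 q
        = massInner m (internalPart m P.1 q) (internalPart m P.1 q) := Real.mul_self_sqrt hJ.le
    have hr0 : internalRadius m P.1 q ≠ 0 := (Real.sqrt_pos.mpr hJ).ne'
    have : massInner m (diagonalMap m q P).2.2 (diagonalMap m q P).2.2
        = (internalRadius m P.1 q)⁻¹ * ((internalRadius m P.1 q)⁻¹ *
          massInner m (internalPart m P.1 q) (internalPart m P.1 q)) := by
      simp only [massInner, diagonalMap, Pi.smul_apply, real_inner_smul_left,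
        real_inner_smul_right, mul_left_comm (m _), ← Finset.mul_sum]
    rw [this, ← hr]
    field_simp

/-- The product of the blow-ups `[M : Δ^E_P]` is closed in the surrounding vector space. -/
lemma isClosed_prod (m : Fin n → ℝ) :
    IsClosed {y : Ambient n E | ∀ P, y P ∈ singleBlowUp m P.1} := by
  have hM : IsClosed {q : Fin n → E | q ∈ configSpace m} := by
    change IsClosed {q : Fin n → E | ∑ i, m i • q i = 0}
    exact isClosed_eq (by fun_prop) continuous_const
  have hext : ∀ P, IsClosed {q : Fin n → E | q ∈ externalSpace m P} := by
    intro P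
    have : {q : Fin n → E | q ∈ externalSpace m P} = {q : Fin n → E | q ∈ configSpace m} ∩
        ⋂ i, ⋂ j, ⋂ (_ : P.part i = P.part j), {q : Fin n → E | q i = q j} := by
      ext q; simp [externalSpace]
    rw [this]
    refine hM.inter (isClosed_iInter fun i => isClosed_iInter fun j => isClosed_iInter fun _ => ?_)
    exact isClosed_eq (continuous_apply i) (continuous_apply j)
  have hint : ∀ P, IsClosed {q : Fin n → E | q ∈ internalSpace m P} := by
    intro P
    have : {q : Fin n → E | q ∈ internalSpace m P} = {q : Fin n → E | q ∈ configSpace m} ∩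
        ⋂ q' ∈ externalSpace m P, {q : Fin n → E | massInner m q q' = 0} := by
      ext q; simp [internalSpace]
    rw [this]
    refine hM.inter (isClosed_iInter fun q' => isClosed_iInter fun _ => ?_)
    exact isClosed_eq (by unfold massInner; fun_prop) continuous_const
  have hs : ∀ P, IsClosed {y : (Fin n → E) × ℝ × (Fin n → E) | y ∈ singleBlowUp m P} := by
    intro P
    have : {y : (Fin n → E) × ℝ × (Fin n → E) | y ∈ singleBlowUp m P}
        = (Prod.fst ⁻¹' {q | q ∈ externalSpace m P}) ∩ ({y | 0 ≤ y.2.1} ∩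
          (((fun y => y.2.2) ⁻¹' {q | q ∈ internalSpace m P}) ∩
            {y | massInner m y.2.2 y.2.2 = 1})) := by
      ext y; simp [singleBlowUp]
    rw [this]
    refine ((hext P).preimage continuous_fst).inter (IsClosed.inter ?_ (IsClosed.inter ?_ ?_))
    · exact isClosed_le continuous_const (by fun_prop)
    · exact (hint P).preimage (by fun_prop)
    · exact isClosed_eq (by unfold massInner; fun_prop) continuous_const
  have : {y : Ambient n E | ∀ P, y P ∈ singleBlowUp m P.1}
      = ⋂ P : CollisionCluster n, (fun y : Ambient n E => y P) ⁻¹'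
          {z | z ∈ singleBlowUp m P.1} := by
    ext y; simp
  rw [this]
  exact isClosed_iInter fun P => (hs P.1).preimage (continuous_apply P)

end NBody

end

/-!
The blow-up splits into closed, pairwise disjoint pieces, one for each ordering `σ` of the
particles: the closures `chamberBlowUp m σ` of the images of the chambers. In a chamber the
configuration is determined by its gaps `x k > 0` between neighbouring particles, and for a cluster
decomposition `P` the internal part `q^I_P` depends only on the gaps enclosed by the atoms of `P`
(`internalPart_congr_gap`). As long as the gaps are nonnegative, `q^I_P` vanishes only if all these
gaps do (`gap_eq_zero_of_internalPart`). So a point of `chamberBlowUp m σ` amounts to the gaps `x`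
together with the limits of all ratios `x i / (x i + x j)` (`ratioData_injOn`).

Topology. On the space of these data (`ratioSpace`), let
`moment i = x i + ∑ j, x i / (x i + x j)`; in the variables `log x i` this is the gradient of the
convex function `∑ i, x i + ½ ∑ i j, log (x i + x j)`. Monotonicity of gradients survives the
passage to the closure and makes `moment` injective (`moment_injOn`). If some gap vanishes, the sum
of `moment` over the vanishing gaps is as small as it can be; this makes `moment` injective even
modulo constant vectors there (`moment_injOn_boundary`). Minimising the convex function, minus a
linear one, on the hyperplanes `∑ i, log x i = -N` and letting `N → ∞` shows that every vector
modulo constants is attained (`momentCoord_surjOn`). On the part `chamberBoundary` of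
`chamberBlowUp m σ` where some gap vanishes, this gives a continuous bijection onto `ℝ^(n-2)`. It is
proper (`isProperMap_momentCoord`), hence a homeomorphism.

Smooth structure. It remains to see that `chamberBoundary` is the part of the boundary in
`chamberBlowUp m σ`. At the image of a noncollision configuration no corner chart can have a
vanishing boundary coordinate, as that coordinate would have a local minimum there, while the chart
is an immersion (`diagonalMap_notMem_stratum`). Conversely, if exactly the gaps in `A ≠ ∅` are
scaled to zero along a direction all of whose coordinates are positive, the limit point has an
explicit chart with values in `[0,∞) × ℝ^(n-2)` (`collapseChart`), and such points are dense in
`chamberBoundary` (`chamberBoundary_subset_closure`).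
-/

noncomputable section

/-! ### The moment map on the space of ratios -/

namespace RatioSpace

open Filter Topology

variable {ι : Type*} [Fintype ι]

/-- Pairs of a vector `x` and a matrix that stands for its ratios `x i / (x i + x j)`. -/
abbrev RatioData (ι : Type*) : Type _ := (ι → ℝ) × (ι → ι → ℝ)

/-- A circulation `f` on a finite set that flows only downhill with respect to a total preorder
vanishes: pairing the conservation law with the rank function of the preorder gives a vanishing sum
of nonnegative terms. -/
theorem circulation_eq_zero {κ : Type*} [Fintype κ] (R : κ → κ → Prop)
    (htot : ∀ i j, R i j ∨ R j i) (htrans : ∀ i j k, R i j → R j k → R i k)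
    (f : κ → κ → ℝ) (hanti : ∀ i j, f i j = -f j i) (hR : ∀ i j, R i j → f i j ≤ 0)
    (hs : ∀ i, ∑ j, f i j = 0) (i j : κ) : f i j = 0 := by
  classical
  set w : κ → ℝ := fun i => ((Finset.univ.filter fun k => R k i).card : ℝ) with hw
  have hmono : ∀ i j, R i j → w i ≤ w j := fun i j h => by
    simp only [hw, Nat.cast_le]
    refine Finset.card_le_card fun k hk => ?_
    simp only [Finset.mem_filter, Finset.mem_univ, true_and] at hk ⊢
    exact htrans _ _ _ hk h
  have hlt : ∀ i j, R i j → ¬ R j i → w i < w j := fun i j h h' => by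
    simp only [hw, Nat.cast_lt]
    refine Finset.card_lt_card (Finset.ssubset_iff_subset_ne.mpr ⟨fun k hk => ?_, fun he => ?_⟩)
    · simp only [Finset.mem_filter, Finset.mem_univ, true_and] at hk ⊢
      exact htrans _ _ _ hk h
    · have : j ∈ Finset.univ.filter fun k => R k j := by simpa using htot j j
      rw [← he] at this
      exact h' (by simpa using this)
  have hpos : ∀ i j, 0 ≤ (w i - w j) * f i j := fun i j => by
    rcases htot i j with h | h
    · exact mul_nonneg_of_nonpos_of_nonpos (sub_nonpos.mpr (hmono _ _ h)) (hR _ _ h)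
    · have h1 := hR _ _ h
      have h2 := hanti i j
      exact mul_nonneg (sub_nonneg.mpr (hmono _ _ h)) (by linarith)
  have h1 : ∑ i, ∑ j, w i * f i j = 0 := by
    simp [← Finset.mul_sum, hs]
  have h2 : ∑ i, ∑ j, w j * f i j = 0 := by
    rw [Finset.sum_comm]
    refine Finset.sum_eq_zero fun j _ => ?_
    rw [← Finset.mul_sum, Finset.sum_congr rfl fun i _ => hanti i j]
    simp [hs]
  have hsum : ∑ i, ∑ j, (w i - w j) * f i j = 0 := by
    simp [sub_mul, Finset.sum_sub_distrib, h1, h2]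
  have h3 := (Finset.sum_eq_zero_iff_of_nonneg
    (fun i _ => Finset.sum_nonneg fun j _ => hpos i j)).mp hsum i (Finset.mem_univ i)
  have h4 := (Finset.sum_eq_zero_iff_of_nonneg (fun j _ => hpos i j)).mp h3 j (Finset.mem_univ j)
  rcases mul_eq_zero.mp h4 with h | h
  · rcases htot i j with h' | h'
    · by_cases h'' : R j i
      · have a := hR _ _ h'
        have b := hR _ _ h''
        have c := hanti i j
        linarith
      · exact absurd h (by have := hlt _ _ h' h''; linarith)
    · by_cases h'' : R i j
      · have a := hR _ _ h'
        have b := hR _ _ h''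
        have c := hanti i j
        linarith
      · exact absurd h (by have := hlt _ _ h' h''; linarith)
  · exact h

/-- A vector with its matrix of ratios. Symmetric expressions `x i / (x i + x j)` are used instead
of `x i / x j` since they stay bounded when entries tend to zero. -/
def ratioMap (x : ι → ℝ) : RatioData ι := (x, fun i j => x i / (x i + x j))

/-- The closure of the set of positive vectors with their ratios. -/
def ratioSpace (ι : Type*) [Fintype ι] : Set (RatioData ι) :=
  closure (ratioMap '' {x | ∀ i, 0 < x i})

/-- In the variables `ξ i = log x i`, the gradient of
`∑ i, exp (ξ i) + ½ ∑ i j, log (exp (ξ i) + exp (ξ j))`. The diagonal terms are `1 / 2`. -/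
def moment (p : RatioData ι) (i : ι) : ℝ := p.1 i + ∑ j, p.2 i j

lemma continuous_moment (i : ι) : Continuous fun p : RatioData ι => moment p i := by
  unfold moment
  fun_prop

/-- Order the indices, and an additional index standing for the constant entry `1`, by the size of
`log x i - log x' i` along an ultrafilter converging to `(p, p')`. The differences of the ratios
then flow downhill, and equality of the moments is the conservation law of this flow. -/
theorem moment_injOn {p p' : RatioData ι} (hp : p ∈ ratioSpace ι)
    (hp' : p' ∈ ratioSpace ι) (h : ∀ i, moment p i = moment p' i) : p = p' := by
  have hpp : (p, p') ∈ closure ((ratioMap '' {x : ι → ℝ | ∀ i, 0 < x i}) ×ˢ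
      (ratioMap '' {x : ι → ℝ | ∀ i, 0 < x i})) := by
    rw [closure_prod_eq]; exact ⟨hp, hp'⟩
  obtain ⟨U, hU, hUle⟩ := mem_closure_iff_ultrafilter.mp hpp
  -- `none` is the index of the constant entry `1`.
  set a : RatioData ι → Option ι → ℝ := fun z o => o.elim 1 z.1 with ha
  have hpos : ∀ᶠ z : RatioData ι × RatioData ι in U, (∀ o, 0 < a z.1 o) ∧ (∀ o, 0 < a z.2 o) ∧
      (∀ i j, z.1.2 i j = z.1.1 i / (z.1.1 i + z.1.1 j)) ∧
      (∀ i j, z.2.2 i j = z.2.1 i / (z.2.1 i + z.2.1 j)) := by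
    filter_upwards [hU] with z hz
    obtain ⟨⟨x, hx, h1⟩, ⟨x', hx', h2⟩⟩ := hz
    rw [← h1, ← h2]
    refine ⟨fun o => ?_, fun o => ?_, fun _ _ => rfl, fun _ _ => rfl⟩
    · cases o
      · simp [ha]
      · exact hx _
    · cases o
      · simp [ha]
      · exact hx' _
  set R : Option ι → Option ι → Prop :=
    fun i j => ∀ᶠ z : RatioData ι × RatioData ι in U, a z.1 i * a z.2 j ≤ a z.1 j * a z.2 i
  have htot : ∀ i j, R i j ∨ R j i := fun i j =>
    Ultrafilter.eventually_or.mp (Eventually.of_forall fun z => le_total _ _)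
  have htrans : ∀ i j k, R i j → R j k → R i k := fun i j k hij hjk => by
    filter_upwards [hij, hjk, hpos] with z h1 h2 h3
    obtain ⟨h3, h4, -⟩ := h3
    have e1 := mul_le_mul_of_nonneg_right h1 (h4 k).le
    have e2 := mul_le_mul_of_nonneg_right h2 (h4 i).le
    have : (a z.1 i * a z.2 k) * a z.2 j ≤ (a z.1 k * a z.2 i) * a z.2 j := by linarith
    exact le_of_mul_le_mul_right this (h4 j)
  set f : Option ι → Option ι → ℝ := fun i j => match i, j with
    | none, none => 0
    | some i, none => p.1 i - p'.1 i
    | none, some j => -(p.1 j - p'.1 j)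
    | some i, some j => p.2 i j - p'.2 i j with hf
  have t1 : Tendsto (fun z : RatioData ι × RatioData ι => z) U
    (𝓝 (p, p')) := hUle
  have tx : ∀ i, Tendsto (fun z : RatioData ι × RatioData ι =>
      z.1.1 i - z.2.1 i) U (𝓝 (p.1 i - p'.1 i)) := fun i =>
    ((by fun_prop : Continuous fun z : RatioData ι × RatioData ι =>
      z.1.1 i - z.2.1 i).tendsto (p, p')).comp t1
  have tr : ∀ i j, Tendsto (fun z : RatioData ι × RatioData ι =>
      z.1.2 i j - z.2.2 i j) U (𝓝 (p.2 i j - p'.2 i j)) := fun i j =>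
    ((by fun_prop : Continuous fun z : RatioData ι × RatioData ι =>
      z.1.2 i j - z.2.2 i j).tendsto (p, p')).comp t1
  have hone : ∀ i j, p.2 i j + p.2 j i = p'.2 i j + p'.2 j i := fun i j => by
    have : Tendsto (fun z : RatioData ι × RatioData ι =>
      (z.1.2 i j - z.2.2 i j) + (z.1.2 j i - z.2.2 j i)) U (𝓝 0) := by
      refine tendsto_const_nhds.congr' ?_
      filter_upwards [hpos] with z ⟨h1, h2, h3, h4⟩
      have a1 : 0 < z.1.1 i := h1 (some i)
      have a2 : 0 < z.1.1 j := h1 (some j)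
      have a3 : 0 < z.2.1 i := h2 (some i)
      have a4 : 0 < z.2.1 j := h2 (some j)
      rw [h3, h3, h4, h4]
      field_simp
      ring
    have := tendsto_nhds_unique ((tr i j).add (tr j i)) this
    linarith
  have hanti : ∀ i j, f i j = -f j i := by
    rintro (_ | i) (_ | j)
    · simp [hf]
    · simp [hf]
    · simp [hf]
    · simp only [hf]
      linarith [hone i j]
  have hR : ∀ i j, R i j → f i j ≤ 0 := by
    rintro (_ | i) (_ | j) h
    · simp [hf]
    · simp only [hf, neg_nonpos]
      refine ge_of_tendsto (tx j) ?_
      filter_upwards [h] with z hz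
      simp only [ha, Option.elim] at hz
      linarith
    · simp only [hf]
      refine le_of_tendsto (tx i) ?_
      filter_upwards [h] with z hz
      simp only [ha, Option.elim] at hz
      linarith
    · simp only [hf]
      refine le_of_tendsto (tr i j) ?_
      filter_upwards [h, hpos] with z hz ⟨h1, h2, h3, h4⟩
      have a1 : 0 < z.1.1 i := h1 (some i)
      have a2 : 0 < z.1.1 j := h1 (some j)
      have a3 : 0 < z.2.1 i := h2 (some i)
      have a4 : 0 < z.2.1 j := h2 (some j)
      simp only [ha, Option.elim] at hz
      rw [h3, h4, sub_nonpos, div_le_div_iff₀ (by positivity) (by positivity)]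
      linarith
  have hs' : ∀ i, ∑ j, f (some i) j = 0 := fun i => by
    rw [Fintype.sum_option]
    simp only [hf, Finset.sum_sub_distrib]
    have := h i
    simp only [moment] at this
    linarith
  have hs : ∀ i, ∑ j, f i j = 0 := by
    rintro (_ | i)
    · have h1 : ∑ i, ∑ j, f i j = 0 := by
        have : ∑ i, ∑ j, f i j = - ∑ i, ∑ j, f i j := by
          conv_lhs => rw [Finset.sum_comm]
          rw [← Finset.sum_neg_distrib]
          refine Finset.sum_congr rfl fun i _ => ?_
          rw [← Finset.sum_neg_distrib]
          exact Finset.sum_congr rfl fun j _ => hanti j i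
        linarith
      rw [Fintype.sum_option, Finset.sum_congr rfl fun i _ => hs' i] at h1
      simpa using h1
    · exact hs' i
  have hf0 := circulation_eq_zero R htot htrans f hanti hR hs
  refine Prod.ext (funext fun i => ?_) (funext fun i => funext fun j => ?_)
  · have := hf0 (some i) none
    simp only [hf] at this
    linarith
  · have := hf0 (some i) (some j)
    simp only [hf] at this
    linarith

/-- The relations between entries and ratios that survive in the closure. -/
lemma ratioSpace_props {p : RatioData ι} (hp : p ∈ ratioSpace ι) :
    (∀ i, 0 ≤ p.1 i) ∧ (∀ i j, 0 ≤ p.2 i j) ∧ (∀ i j, p.2 i j + p.2 j i = 1) ∧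
      ∀ i j, p.2 i j * (p.1 i + p.1 j) = p.1 i := by
  have hcl : IsClosed {p : RatioData ι | (∀ i, 0 ≤ p.1 i) ∧ (∀ i j, 0 ≤ p.2 i j) ∧
      (∀ i j, p.2 i j + p.2 j i = 1) ∧ ∀ i j, p.2 i j * (p.1 i + p.1 j) = p.1 i} := by
    simp only [Set.ofPred_and, Set.ofPred_forall]
    refine IsClosed.inter (isClosed_iInter fun i => ?_) (IsClosed.inter
      (isClosed_iInter fun i => isClosed_iInter fun j => ?_) (IsClosed.inter
      (isClosed_iInter fun i => isClosed_iInter fun j => ?_)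
      (isClosed_iInter fun i => isClosed_iInter fun j => ?_)))
    · exact isClosed_le continuous_const (by fun_prop)
    · exact isClosed_le continuous_const (by fun_prop)
    · exact isClosed_eq (by fun_prop) continuous_const
    · exact isClosed_eq (by fun_prop) (by fun_prop)
  refine closure_minimal ?_ hcl hp
  rintro _ ⟨x, hx, rfl⟩
  refine ⟨fun i => (hx i).le, fun i j => (div_pos (hx i) (add_pos (hx i) (hx j))).le,
    fun i j => ?_, fun i j => ?_⟩
  · have := hx i; have := hx j
    simp only [ratioMap]
    field_simp
    ring
  · have := hx i; have := hx j
    simp only [ratioMap]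
    field_simp

/-- Over the zero set `A` of `p`, the sum of the moments of `p` has the smallest possible value,
the half of `|A|²`, since the ratios of vanishing to nonvanishing entries are zero. -/
lemma sum_moment_le {p p' : RatioData ι} (hp : p ∈ ratioSpace ι)
    (hp' : p' ∈ ratioSpace ι) :
    ∑ i with p.1 i = 0, moment p i ≤ ∑ i with p.1 i = 0, moment p' i := by
  classical
  obtain ⟨hx, hθ, h1, h2⟩ := ratioSpace_props hp
  obtain ⟨hx', hθ', h1', h2'⟩ := ratioSpace_props hp'
  set A : Finset ι := Finset.univ.filter fun i => p.1 i = 0 with hA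
  have key : ∀ r : RatioData ι, (∀ i j, r.2 i j + r.2 j i = 1) →
      ∑ i ∈ A, ∑ j ∈ A, r.2 i j = (A.card : ℝ) * A.card / 2 := fun r hr => by
    have e : ∑ i ∈ A, ∑ j ∈ A, r.2 i j = ∑ i ∈ A, ∑ j ∈ A, r.2 j i := Finset.sum_comm
    have e' : ∑ i ∈ A, ∑ j ∈ A, r.2 i j + ∑ i ∈ A, ∑ j ∈ A, r.2 j i = (A.card : ℝ) * A.card := by
      simp only [← Finset.sum_add_distrib, hr]
      simp
    linarith
  calc ∑ i ∈ A, moment p i = ∑ i ∈ A, ∑ j ∈ A, p.2 i j := by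
        refine Finset.sum_congr rfl fun i hi => ?_
        have hi0 : p.1 i = 0 := by simpa [hA] using hi
        rw [moment, hi0, zero_add]
        refine (Finset.sum_subset (Finset.subset_univ A) fun j _ hj => ?_).symm
        have hj0 : p.1 j ≠ 0 := by simpa [hA] using hj
        have := h2 i j
        rw [hi0, zero_add] at this
        exact (mul_eq_zero.mp this).resolve_right hj0
    _ = ∑ i ∈ A, ∑ j ∈ A, p'.2 i j := by rw [key p h1, key p' h1']
    _ ≤ ∑ i ∈ A, moment p' i := by
        refine Finset.sum_le_sum fun i _ => ?_
        rw [moment]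
        have := Finset.sum_le_sum_of_subset_of_nonneg (Finset.subset_univ A)
          (f := fun j => p'.2 i j) fun j _ _ => hθ' i j
        linarith [hx' i]

/-- On points with a vanishing entry, `moment` is injective modulo constant vectors. -/
theorem moment_injOn_boundary {p p' : RatioData ι} (hp : p ∈ ratioSpace ι)
    (hp' : p' ∈ ratioSpace ι) (h0 : ∃ i, p.1 i = 0) (h0' : ∃ i, p'.1 i = 0) {t : ℝ}
    (h : ∀ i, moment p i = moment p' i + t) : p = p' := by
  have aux : ∀ (p p' : RatioData ι) (t : ℝ), p ∈ ratioSpace ι → p' ∈ ratioSpace ι →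
      (∃ i, p.1 i = 0) → (∀ i, moment p i = moment p' i + t) → t ≤ 0 := by
    intro p p' t hp hp' ⟨i, hi⟩ h
    have h1 := sum_moment_le hp hp'
    rw [Finset.sum_congr rfl fun i _ => h i, Finset.sum_add_distrib, Finset.sum_const,
      nsmul_eq_mul] at h1
    have hc : 0 < ((Finset.univ.filter fun i => p.1 i = 0).card : ℝ) := by
      exact_mod_cast Finset.card_pos.mpr ⟨i, by simpa using hi⟩
    by_contra! ht
    linarith [mul_pos hc ht]
  have ht : t = 0 := le_antisymm (aux p p' t hp hp' h0 h) (by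
    have := aux p' p (-t) hp' hp h0' fun i => by rw [h i]; ring
    linarith)
  subst ht
  exact moment_injOn hp hp' fun i => by simpa using h i

lemma moment_le_card {p : RatioData ι} (hp : p ∈ ratioSpace ι) (i : ι) :
    moment p i ≤ p.1 i + Fintype.card ι := by
  obtain ⟨-, hθ, h1, -⟩ := ratioSpace_props hp
  have : ∑ j, p.2 i j ≤ ∑ _j : ι, (1 : ℝ) :=
    Finset.sum_le_sum fun j _ => by linarith [hθ j i, h1 i j]
  simp only [Finset.sum_const, Finset.card_univ, nsmul_eq_mul, mul_one] at this
  rw [moment]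
  linarith

lemma le_moment {p : RatioData ι} (hp : p ∈ ratioSpace ι) (i : ι) :
    p.1 i ≤ moment p i := by
  obtain ⟨-, hθ, -, -⟩ := ratioSpace_props hp
  have : 0 ≤ ∑ j, p.2 i j := Finset.sum_nonneg fun j _ => hθ i j
  rw [moment]
  linarith

/-- The convex function with gradient `moment - h` in logarithmic variables. -/
def potential (h ξ : ι → ℝ) : ℝ :=
  ∑ i, (Real.exp (ξ i) - h i * ξ i) + (∑ i, ∑ j, Real.log (Real.exp (ξ i) + Real.exp (ξ j))) / 2

lemma continuous_potential (h : ι → ℝ) : Continuous (potential h) := by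
  unfold potential
  refine Continuous.add (by fun_prop) (Continuous.div_const (continuous_finsetSum _ fun i _ =>
    continuous_finsetSum _ fun j _ => Continuous.log (by fun_prop) fun ξ => ?_) 2)
  positivity

/-- The potential is coercive on hyperplanes `∑ i, ξ i = N`, provided that `1 ≤ h`. -/
lemma le_potential {h : ι → ℝ} (hh : ∀ i, 1 ≤ h i) (ξ : ι → ℝ) (k : ι) :
    |ξ k| - ∑ i, (h i + 1) ^ 2 / 2 + Fintype.card ι * (∑ i, ξ i) / 2 ≤ potential h ξ := by
  have h1 : ∀ i, |ξ i| - (h i + 1) ^ 2 / 2 ≤ Real.exp (ξ i) - h i * ξ i := fun i => by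
    rcases le_total 0 (ξ i) with h0 | h0
    · rw [abs_of_nonneg h0]
      have := Real.quadratic_le_exp_of_nonneg h0
      nlinarith [sq_nonneg (ξ i - (h i + 1))]
    · rw [abs_of_nonpos h0]
      have := Real.exp_pos (ξ i)
      nlinarith [sq_nonneg (h i + 1), hh i]
  have h2 : ∀ i j, (ξ i + ξ j) / 2 ≤ Real.log (Real.exp (ξ i) + Real.exp (ξ j)) := fun i j => by
    rw [Real.le_log_iff_exp_le (by positivity)]
    rcases le_total (ξ i) (ξ j) with h0 | h0
    · have := Real.exp_le_exp.mpr (show (ξ i + ξ j) / 2 ≤ ξ j by linarith)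
      linarith [Real.exp_pos (ξ i)]
    · have := Real.exp_le_exp.mpr (show (ξ i + ξ j) / 2 ≤ ξ i by linarith)
      linarith [Real.exp_pos (ξ j)]
  have h3 : (Fintype.card ι : ℝ) * (∑ i, ξ i) ≤
      ∑ i, ∑ j, Real.log (Real.exp (ξ i) + Real.exp (ξ j)) := by
    calc (Fintype.card ι : ℝ) * (∑ i, ξ i) = ∑ i, ∑ j, (ξ i + ξ j) / 2 := by
          simp only [← Finset.sum_div, Finset.sum_add_distrib, Finset.sum_const,
            Finset.card_univ, nsmul_eq_mul, ← Finset.mul_sum]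
          ring
      _ ≤ _ := Finset.sum_le_sum fun i _ => Finset.sum_le_sum fun j _ => h2 i j
  have h4 : |ξ k| - ∑ i, (h i + 1) ^ 2 / 2 ≤ ∑ i, (Real.exp (ξ i) - h i * ξ i) := by
    have := Finset.sum_le_sum fun i (_ : i ∈ Finset.univ) => h1 i
    rw [Finset.sum_sub_distrib] at this
    have := Finset.single_le_sum (fun i _ => abs_nonneg (ξ i)) (Finset.mem_univ k)
    linarith
  rw [potential]
  linarith

lemma hasDerivAt_potential (h ξ w : ι → ℝ) :
    HasDerivAt (fun s : ℝ => potential h (ξ + s • w))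
      (∑ i, w i * (moment (ratioMap fun i => Real.exp (ξ i)) i - h i)) 0 := by
  have e1 : ∀ i, HasDerivAt (fun s : ℝ => Real.exp (ξ i + s * w i)) (Real.exp (ξ i) * w i) 0 :=
    fun i => by
      have : HasDerivAt (fun s : ℝ => ξ i + s * w i) (w i) 0 := by
        simpa using ((hasDerivAt_id (0 : ℝ)).mul_const (w i)).const_add (ξ i)
      simpa using this.exp
  have e0 : ∀ i, HasDerivAt (fun s : ℝ => ξ i + s * w i) (w i) 0 := fun i => by
    simpa using ((hasDerivAt_id (0 : ℝ)).mul_const (w i)).const_add (ξ i)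
  have e2 : ∀ i j, HasDerivAt (fun s : ℝ => Real.log (Real.exp (ξ i + s * w i) +
      Real.exp (ξ j + s * w j))) ((Real.exp (ξ i) * w i + Real.exp (ξ j) * w j) /
        (Real.exp (ξ i) + Real.exp (ξ j))) 0 := fun i j => by
    have := ((e1 i).add (e1 j)).log (by simp only [Pi.add_apply]; positivity)
    simpa using this
  have e3 := (HasDerivAt.fun_sum fun i (_ : i ∈ Finset.univ) =>
    (e1 i).sub ((e0 i).const_mul (h i))).add
    ((HasDerivAt.fun_sum fun i (_ : i ∈ Finset.univ) => HasDerivAt.fun_sum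
      fun j (_ : j ∈ Finset.univ) => e2 i j).div_const 2)
  refine e3.congr_deriv ?_
  have e4 : ∑ i, ∑ j, (Real.exp (ξ i) * w i + Real.exp (ξ j) * w j) /
      (Real.exp (ξ i) + Real.exp (ξ j)) = 2 * ∑ i, w i * ∑ j, Real.exp (ξ i) /
      (Real.exp (ξ i) + Real.exp (ξ j)) := by
    simp only [add_div, Finset.sum_add_distrib, two_mul]
    congr 1
    · simp only [Finset.mul_sum]
      exact Finset.sum_congr rfl fun i _ => Finset.sum_congr rfl fun j _ => by ring
    · rw [Finset.sum_comm]
      simp only [Finset.mul_sum]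
      exact Finset.sum_congr rfl fun i _ => Finset.sum_congr rfl fun j _ => by
        rw [add_comm (Real.exp (ξ j))]; ring
  rw [e4]
  simp only [moment, ratioMap]
  rw [mul_div_cancel_left₀ _ two_ne_zero, ← Finset.sum_add_distrib]
  exact Finset.sum_congr rfl fun i _ => by ring

/-- Modulo constants, every vector is the moment of a positive vector with prescribed product: the
constant is the Lagrange multiplier of the minimisation of `potential` on a hyperplane. -/
theorem exists_moment_eq [Nonempty ι] (h : ι → ℝ) (N : ℝ) :
    ∃ x : ι → ℝ, (∀ i, 0 < x i) ∧ ∏ i, x i = Real.exp N ∧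
      ∃ t, ∀ i, moment (ratioMap x) i = h i + t := by
  classical
  -- Adding a constant to `h` makes the potential coercive; it is absorbed by `t`.
  obtain ⟨c, hc⟩ : ∃ c : ℝ, ∀ i, 1 ≤ h i + c := by
    obtain ⟨b, hb⟩ := (Set.finite_range h).bddBelow
    exact ⟨1 - b, fun i => by have := hb ⟨i, rfl⟩; linarith⟩
  set g : ι → ℝ := fun i => h i + c with hg
  set H : Set (ι → ℝ) := {ξ | ∑ i, ξ i = N} with hH
  have hHc : IsClosed H := isClosed_eq (by fun_prop) continuous_const
  obtain ⟨ξ₀, hξ₀⟩ : H.Nonempty := by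
    refine ⟨fun _ => N / Fintype.card ι, ?_⟩
    have : (Fintype.card ι : ℝ) ≠ 0 := by exact_mod_cast Fintype.card_ne_zero
    simp only [hH, Set.mem_ofPred_eq, Finset.sum_const, Finset.card_univ, nsmul_eq_mul]
    field_simp
  set C := potential g ξ₀ + ∑ i, (g i + 1) ^ 2 / 2 - Fintype.card ι * N / 2 with hC
  have hbound : ∀ ξ ∈ H, potential g ξ ≤ potential g ξ₀ → ξ ∈ Metric.closedBall (0 : ι → ℝ) C := by
    intro ξ hξ hle
    have hk : ∀ k, |ξ k| ≤ C := fun k => by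
      have := le_potential hc ξ k
      rw [show ∑ i, ξ i = N from hξ] at this
      linarith
    rw [mem_closedBall_zero_iff]
    exact (pi_norm_le_iff_of_nonneg ((abs_nonneg _).trans (hk (Classical.arbitrary ι)))).mpr hk
  obtain ⟨ξ, ⟨hξ, -⟩, hmin⟩ := ((isCompact_closedBall (0 : ι → ℝ) C).inter_left hHc).exists_isMinOn
    ⟨ξ₀, hξ₀, hbound ξ₀ hξ₀ le_rfl⟩ (continuous_potential g).continuousOn
  have hmin' : ∀ η ∈ H, potential g ξ ≤ potential g η := fun η hη => by
    rcases le_total (potential g η) (potential g ξ₀) with h' | h'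
    · exact hmin ⟨hη, hbound η hη h'⟩
    · exact (hmin ⟨hξ₀, hbound ξ₀ hξ₀ le_rfl⟩).trans h'
  have hcrit : ∀ a b : ι, moment (ratioMap fun i => Real.exp (ξ i)) a - g a =
      moment (ratioMap fun i => Real.exp (ξ i)) b - g b := fun a b => by
    have hd := hasDerivAt_potential g ξ (Pi.single a 1 - Pi.single b 1)
    have hm : IsLocalMin
        (fun s : ℝ => potential g (ξ + s • (Pi.single a 1 - Pi.single b 1))) 0 := by
      refine Eventually.of_forall fun s => ?_
      simp only [zero_smul, add_zero]
      refine hmin' _ ?_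
      have hξ' : ∑ i, ξ i = N := hξ
      simp only [hH, Set.mem_ofPred_eq, Pi.add_apply, Pi.smul_apply, Pi.sub_apply, smul_eq_mul,
        Finset.sum_add_distrib, ← Finset.mul_sum, Finset.sum_sub_distrib, hξ']
      simp
    have := hm.hasDerivAt_eq_zero hd
    simp only [Pi.sub_apply, sub_mul, Finset.sum_sub_distrib, Pi.single_apply, ite_mul, one_mul,
      zero_mul, Finset.sum_ite_eq', Finset.mem_univ, if_true] at this
    linarith
  refine ⟨fun i => Real.exp (ξ i), fun i => Real.exp_pos _, ?_, ?_⟩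
  · rw [← Real.exp_sum]
    exact congrArg Real.exp hξ
  · refine ⟨moment (ratioMap fun i => Real.exp (ξ i)) (Classical.arbitrary ι) -
      g (Classical.arbitrary ι) + c, fun i => ?_⟩
    have := hcrit i (Classical.arbitrary ι)
    simp only [hg] at this ⊢
    linarith

end RatioSpace

namespace NBody

open Filter Topology

/-! ### Internal parts and general properties of the blow-up -/

section Projections

variable {n : ℕ} {m : Fin n → ℝ}

lemma massInner_real (q q' : Fin n → ℝ) : massInner m q q' = ∑ i, m i * (q i * q' i) :=
  Finset.sum_congr rfl fun i _ => by
    rw [real_inner_eq_re_inner, RCLike.inner_apply]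
    simp [mul_comm]

variable (m) in
/-- `q ↦ q^I_P` as a linear map. -/
def internalLinear (P : Cluster n) : (Fin n → ℝ) →ₗ[ℝ] (Fin n → ℝ) where
  toFun := internalPart m P
  map_add' q q' := by
    ext i
    simp only [internalPart, externalPart, Pi.sub_apply, Pi.add_apply, smul_add,
      Finset.sum_add_distrib]
    ring
  map_smul' c q := by
    ext i
    simp only [internalPart, externalPart, Pi.sub_apply, Pi.smul_apply, smul_eq_mul,
      RingHom.id_apply, mul_sub, Finset.mul_sum]
    congr 1
    exact Finset.sum_congr rfl fun j _ => by ring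

variable (m) in
/-- The direction `q^I_P / ‖q^I_P‖` of the internal part, with value `0` if `q^I_P = 0`. -/
def unitPart (P : Cluster n) (q : Fin n → ℝ) : Fin n → ℝ :=
  (internalRadius m P q)⁻¹ • internalPart m P q

lemma internalPart_sub (P : Cluster n) (q q' : Fin n → ℝ) :
    internalPart m P (q - q') = internalPart m P q - internalPart m P q' :=
  (internalLinear m P).map_sub q q'

lemma internalPart_smul (P : Cluster n) (c : ℝ) (q : Fin n → ℝ) :
    internalPart m P (c • q) = c • internalPart m P q :=
  (internalLinear m P).map_smul c q

lemma external_add_internal (P : Cluster n) (q : Fin n → ℝ) :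
    externalPart m P q + internalPart m P q = q := by
  simp [internalPart]

lemma massInner_self_nonneg (hm : ∀ i, 0 < m i) (q : Fin n → ℝ) : 0 ≤ massInner m q q :=
  Finset.sum_nonneg fun j _ => mul_nonneg (hm j).le real_inner_self_nonneg

lemma internalRadius_nonneg (P : Cluster n) (q : Fin n → ℝ) : 0 ≤ internalRadius m P q :=
  Real.sqrt_nonneg _

lemma internalRadius_eq_zero (hm : ∀ i, 0 < m i) {P : Cluster n} {q : Fin n → ℝ} :
    internalRadius m P q = 0 ↔ internalPart m P q = 0 := by
  rw [internalRadius, Real.sqrt_eq_zero (massInner_self_nonneg hm _)]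
  refine ⟨fun h => ?_, fun h => by simp [h, massInner]⟩
  by_contra hne
  exact (massInner_self_pos hm hne).ne' h

lemma internalRadius_smul (P : Cluster n) {c : ℝ} (hc : 0 ≤ c) (q : Fin n → ℝ) :
    internalRadius m P (c • q) = c * internalRadius m P q := by
  rw [internalRadius, internalRadius, internalPart_smul]
  have : massInner m (c • internalPart m P q) (c • internalPart m P q) =
      c ^ 2 * massInner m (internalPart m P q) (internalPart m P q) := by
    simp only [massInner_real, Finset.mul_sum, Pi.smul_apply, smul_eq_mul]
    exact Finset.sum_congr rfl fun i _ => by ring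
  rw [this, Real.sqrt_mul (sq_nonneg c), Real.sqrt_sq hc]

lemma internalRadius_congr {P : Cluster n} {q q' : Fin n → ℝ}
    (h : internalPart m P q = internalPart m P q') :
    internalRadius m P q = internalRadius m P q' := by
  rw [internalRadius, internalRadius, h]

lemma unitPart_congr {P : Cluster n} {q q' : Fin n → ℝ}
    (h : internalPart m P q = internalPart m P q') : unitPart m P q = unitPart m P q' := by
  rw [unitPart, unitPart, internalRadius_congr h, h]

lemma unitPart_smul (P : Cluster n) {c : ℝ} (hc : 0 < c) (q : Fin n → ℝ) :
    unitPart m P (c • q) = unitPart m P q := by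
  rw [unitPart, unitPart, internalRadius_smul P hc.le, internalPart_smul, smul_smul, mul_inv,
    mul_comm c⁻¹, mul_assoc, inv_mul_cancel₀ hc.ne', mul_one]

lemma internalRadius_smul_unitPart (hm : ∀ i, 0 < m i) (P : Cluster n) (q : Fin n → ℝ) :
    internalRadius m P q • unitPart m P q = internalPart m P q := by
  by_cases h : internalRadius m P q = 0
  · rw [h, zero_smul, (internalRadius_eq_zero hm).mp h]
  · rw [unitPart, smul_smul, mul_inv_cancel₀ h, one_smul]

lemma internalPart_eq_zero_of_const (hm : ∀ i, 0 < m i) {P : Cluster n} {q : Fin n → ℝ}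
    (h : ∀ i j, P.part i = P.part j → q i = q j) : internalPart m P q = 0 := by
  ext i
  have h1 : ∑ j ∈ P.part i, m j * q j = (∑ j ∈ P.part i, m j) * q i := by
    rw [Finset.sum_mul]
    refine Finset.sum_congr rfl fun j hj => ?_
    rw [h i j (P.part_eq_of_mem (P.part_mem.mpr (Finset.mem_univ i)) hj).symm]
  simp only [internalPart, externalPart, Pi.sub_apply, smul_eq_mul, h1, Pi.zero_apply]
  rw [inv_mul_cancel_left₀ (part_sum_ne_zero hm P i), sub_self]

lemma externalPart_const (P : Cluster n) (q : Fin n → ℝ) {i j : Fin n}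
    (h : P.part i = P.part j) : externalPart m P q i = externalPart m P q j := by
  simp only [externalPart, h]

lemma const_of_internalPart_eq_zero {P : Cluster n} {q : Fin n → ℝ}
    (h : internalPart m P q = 0) {i j : Fin n} (hij : P.part i = P.part j) : q i = q j := by
  rw [sub_eq_zero.mp h]
  exact externalPart_const P q hij

lemma internalPart_internalPart (hm : ∀ i, 0 < m i) (P : Cluster n) (q : Fin n → ℝ) :
    internalPart m P (internalPart m P q) = internalPart m P q := by
  conv_lhs => enter [3]; rw [internalPart]
  rw [internalPart_sub, internalPart_eq_zero_of_const hm fun i j => externalPart_const P q,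
    sub_zero]

lemma contDiff_internalPart (P : Cluster n) :
    ContDiff ℝ ∞ (internalPart m P : (Fin n → ℝ) → Fin n → ℝ) :=
  (internalLinear m P).toContinuousLinearMap.contDiff

lemma contDiff_externalPart (P : Cluster n) :
    ContDiff ℝ ∞ (externalPart m P : (Fin n → ℝ) → Fin n → ℝ) := by
  have : (externalPart m P : (Fin n → ℝ) → Fin n → ℝ) = fun q => q - internalPart m P q := by
    ext q; simp [internalPart]
  rw [this]
  exact contDiff_id.sub (contDiff_internalPart P)

lemma contDiff_massInner_self : ContDiff ℝ ∞ fun q : Fin n → ℝ => massInner m q q := by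
  simp only [massInner_real]
  fun_prop

lemma continuous_internalRadius (P : Cluster n) :
    Continuous (internalRadius m P : (Fin n → ℝ) → ℝ) :=
  Real.continuous_sqrt.comp
    ((contDiff_massInner_self (m := m)).comp (contDiff_internalPart P)).continuous

lemma contDiffAt_internalRadius (hm : ∀ i, 0 < m i) {P : Cluster n} {q : Fin n → ℝ}
    (h : internalPart m P q ≠ 0) : ContDiffAt ℝ ∞ (internalRadius m P) q :=
  (((contDiff_massInner_self (m := m)).comp (contDiff_internalPart P)).contDiffAt).sqrt
    (massInner_self_pos hm h).ne'

lemma contDiffAt_unitPart (hm : ∀ i, 0 < m i) {P : Cluster n} {q : Fin n → ℝ}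
    (h : internalPart m P q ≠ 0) : ContDiffAt ℝ ∞ (unitPart m P) q :=
  ((contDiffAt_internalRadius hm h).inv (mt (internalRadius_eq_zero hm).mp h)).smul
    (contDiff_internalPart P).contDiffAt

lemma _root_.ContinuousAt.unitPart {X : Type*} [TopologicalSpace X] {P : Cluster n}
    {f : X → Fin n → ℝ} {x : X} (hf : ContinuousAt f x) (hm : ∀ i, 0 < m i)
    (h : internalPart m P (f x) ≠ 0) : ContinuousAt (fun x => unitPart m P (f x)) x :=
  ContinuousAt.comp (g := NBody.unitPart m P) (contDiffAt_unitPart hm h).continuousAt hf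

lemma diagonalMap_eq (q : Fin n → ℝ) (P : CollisionCluster n) :
    diagonalMap m q P = (externalPart m P.1 q, internalRadius m P.1 q, unitPart m P.1 q) := rfl

/-- The configuration below a point `y` of the blow-up, read off from its component at `P`. On the
blow-up it does not depend on `P`. -/
def position (P : CollisionCluster n) (y : Ambient n ℝ) : Fin n → ℝ :=
  (y P).1 + (y P).2.1 • (y P).2.2

lemma contDiff_position (P : CollisionCluster n) : ContDiff ℝ ∞ (position P) := by
  unfold position
  fun_prop

lemma position_diagonalMap (hm : ∀ i, 0 < m i) (P : CollisionCluster n) (q : Fin n → ℝ) :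
    position P (diagonalMap m q) = q := by
  rw [position, diagonalMap_eq]
  simp only [internalRadius_smul_unitPart hm, external_add_internal]

lemma internalPart_ne_zero_of_injective {q : Fin n → ℝ} (hq : Function.Injective q)
    (P : CollisionCluster n) : internalPart m P.1 q ≠ 0 := fun h => by
  obtain ⟨i, j, hij, hpart⟩ := exists_ne_of_ne_bot P.2
  exact hij (hq (const_of_internalPart_eq_zero h hpart))

lemma contDiffAt_diagonalMap (hm : ∀ i, 0 < m i) {q : Fin n → ℝ} (hq : Function.Injective q) :
    ContDiffAt ℝ ∞ (diagonalMap m) q := by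
  refine contDiffAt_pi.mpr fun P => ?_
  have h := internalPart_ne_zero_of_injective (m := m) hq P
  exact (contDiff_externalPart P.1).contDiffAt.prodMk
    ((contDiffAt_internalRadius hm h).prodMk (contDiffAt_unitPart hm h))

lemma mem_noncollision {q : Fin n → ℝ} :
    q ∈ noncollision m ↔ q ∈ configSpace m ∧ Function.Injective q := by
  refine ⟨fun ⟨h1, h2⟩ => ⟨h1, fun i j hij => ?_⟩, fun ⟨h1, h2⟩ => ⟨h1, fun ⟨_, i, j, hij, h⟩ =>
    hij (h2 h)⟩⟩
  by_contra hne
  exact h2 ⟨h1, i, j, hne, hij⟩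

/-- The closed relations between the components of a point of the blow-up. -/
lemma graphBlowUp_props (hm : ∀ i, 0 < m i) (P₀ : CollisionCluster n) {y : Ambient n ℝ}
    (hy : y ∈ graphBlowUp m) :
    position P₀ y ∈ configSpace m ∧ ∀ P : CollisionCluster n,
      (y P).1 = externalPart m P.1 (position P₀ y) ∧
      (y P).2.1 = internalRadius m P.1 (position P₀ y) ∧
      (y P).2.1 • (y P).2.2 = internalPart m P.1 (position P₀ y) ∧
      internalPart m P.1 (y P).2.2 = (y P).2.2 ∧ massInner m (y P).2.2 (y P).2.2 = 1 := by
  have hpos := (contDiff_position P₀).continuous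
  have hcl : IsClosed {y : Ambient n ℝ | position P₀ y ∈ configSpace m ∧
      ∀ P : CollisionCluster n,
      (y P).1 = externalPart m P.1 (position P₀ y) ∧
      (y P).2.1 = internalRadius m P.1 (position P₀ y) ∧
      (y P).2.1 • (y P).2.2 = internalPart m P.1 (position P₀ y) ∧
      internalPart m P.1 (y P).2.2 = (y P).2.2 ∧ massInner m (y P).2.2 (y P).2.2 = 1} := by
    simp only [Set.ofPred_and, Set.ofPred_forall]
    refine IsClosed.inter ?_ (isClosed_iInter fun P => IsClosed.inter ?_ (IsClosed.inter ?_
      (IsClosed.inter ?_ (IsClosed.inter ?_ ?_))))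
    · exact (configSpace m).closed_of_finiteDimensional.preimage hpos
    · exact isClosed_eq (by fun_prop) ((contDiff_externalPart P.1).continuous.comp hpos)
    · exact isClosed_eq (by fun_prop) ((continuous_internalRadius P.1).comp hpos)
    · exact isClosed_eq (by fun_prop) ((contDiff_internalPart P.1).continuous.comp hpos)
    · exact isClosed_eq ((contDiff_internalPart P.1).continuous.comp (by fun_prop)) (by fun_prop)
    · exact isClosed_eq ((contDiff_massInner_self (m := m)).continuous.comp
        (by fun_prop : Continuous fun y : Ambient n ℝ => (y P).2.2)) continuous_const
  refine closure_minimal ?_ hcl hy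
  rintro _ ⟨q, hq, rfl⟩
  simp only [Set.mem_ofPred_eq, position_diagonalMap hm]
  refine ⟨hq.1, fun P => ⟨rfl, rfl, internalRadius_smul_unitPart hm P.1 q, ?_,
    (diagonalMap_mem hm hq P).2.2.2⟩⟩
  rw [diagonalMap_eq]
  simp only [unitPart, internalPart_smul, internalPart_internalPart hm]

lemma snd_ne_zero_of_mem (hm : ∀ i, 0 < m i) {y : Ambient n ℝ}
    (hy : y ∈ graphBlowUp m) (P : CollisionCluster n) : (y P).2.2 ≠ 0 := fun h0 => by
  obtain ⟨-, h⟩ := graphBlowUp_props hm P hy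
  have := (h P).2.2.2.2
  rw [h0] at this
  simp [massInner] at this

/-- Away from collisions the blow-up is the image of the diagonal map. -/
lemma eq_diagonalMap_of_injective (hm : ∀ i, 0 < m i) (P₀ : CollisionCluster n) {y : Ambient n ℝ}
    (hy : y ∈ graphBlowUp m) (hinj : Function.Injective (position P₀ y)) :
    y = diagonalMap m (position P₀ y) := by
  obtain ⟨-, h⟩ := graphBlowUp_props hm P₀ hy
  funext P
  obtain ⟨h1, h2, h3, -, -⟩ := h P
  refine Prod.ext h1 (Prod.ext h2 ?_)
  have hne := mt (internalRadius_eq_zero hm).mp (internalPart_ne_zero_of_injective (m := m) hinj P)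
  rw [diagonalMap_eq]
  simp only
  rw [unitPart, ← h3, h2, smul_smul, inv_mul_cancel₀ hne, one_smul]

end Projections

/-! ### Gaps between neighbouring particles -/

section Gaps

variable {d : ℕ} {m : Fin (d + 1) → ℝ} (σ : Equiv.Perm (Fin (d + 1)))

/-- The gaps of a configuration whose particles are listed in the order `σ`; they are positive on
the chamber of `σ`. -/
def gap : (Fin (d + 1) → ℝ) →ₗ[ℝ] (Fin d → ℝ) where
  toFun q k := q (σ k.succ) - q (σ k.castSucc)
  map_add' q q' := by ext k; simp only [Pi.add_apply]; ring
  map_smul' c q := by ext k; simp only [Pi.smul_apply, smul_eq_mul, RingHom.id_apply]; ring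

lemma gap_apply (q : Fin (d + 1) → ℝ) (k : Fin d) :
    gap σ q k = q (σ k.succ) - q (σ k.castSucc) := rfl

lemma contDiff_gap : ContDiff ℝ ∞ (gap σ) := (gap σ).toContinuousLinearMap.contDiff

lemma mem_chamber {q : Fin (d + 1) → ℝ} :
    q ∈ chamber m σ ↔ q ∈ configSpace m ∧ ∀ k, 0 < gap σ q k := by
  simp only [chamber, Set.mem_ofPred_eq, gap_apply, sub_pos]
  exact and_congr_right fun _ => Fin.strictMono_iff_lt_succ

lemma injective_of_gap_pos {σ : Equiv.Perm (Fin (d + 1))} {q : Fin (d + 1) → ℝ}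
    (h : ∀ k, 0 < gap σ q k) : Function.Injective q := by
  have h1 : StrictMono fun i => q (σ i) :=
    Fin.strictMono_iff_lt_succ.mpr fun k => by simpa [gap_apply] using h k
  have h2 := h1.injective.comp σ.symm.injective
  have : q = (fun i => q (σ i)) ∘ σ.symm := by ext i; simp
  rwa [this]

lemma chamber_subset_noncollision : chamber m σ ⊆ noncollision m := fun _ hq =>
  mem_noncollision.mpr ⟨hq.1, injective_of_gap_pos ((mem_chamber σ).mp hq).2⟩

lemma le_of_gap_nonneg {q : Fin (d + 1) → ℝ} {a b : Fin (d + 1)} (hab : a ≤ b)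
    (h : ∀ k : Fin d, a ≤ k.castSucc → k.castSucc < b → 0 ≤ gap σ q k) : q (σ a) ≤ q (σ b) := by
  induction b using Fin.induction with
  | zero => rw [Fin.le_zero_iff.mp hab]
  | succ k ih =>
    rcases hab.eq_or_lt with rfl | hlt
    · rfl
    · have hk : a ≤ k.castSucc := Fin.le_castSucc_iff.mpr hlt
      have h1 := ih hk fun l h1 h2 => h l h1 (h2.trans Fin.castSucc_lt_succ)
      have h2 := h k hk Fin.castSucc_lt_succ
      rw [gap_apply] at h2
      linarith

/-- The gaps that lie between two particles of a common atom of `P`. -/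
def enclosed (P : Cluster (d + 1)) : Set (Fin d) :=
  {k | ∃ a b : Fin (d + 1), P.part (σ a) = P.part (σ b) ∧ a ≤ k.castSucc ∧ k.castSucc < b}

lemma internalPart_eq_zero_of_gap (hm : ∀ i, 0 < m i) {P : Cluster (d + 1)}
    {q : Fin (d + 1) → ℝ} (h : ∀ k ∈ enclosed σ P, gap σ q k = 0) : internalPart m P q = 0 := by
  have key : ∀ a b, a ≤ b → P.part (σ a) = P.part (σ b) → q (σ a) = q (σ b) := by
    intro a b hab hp
    refine le_antisymm (le_of_gap_nonneg σ hab fun k h1 h2 => (h k ⟨a, b, hp, h1, h2⟩).ge) ?_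
    have := le_of_gap_nonneg σ (q := -q) hab fun k h1 h2 => by
      rw [map_neg, Pi.neg_apply, h k ⟨a, b, hp, h1, h2⟩, neg_zero]
    simpa using this
  refine internalPart_eq_zero_of_const hm fun i j hij => ?_
  rcases le_total (σ.symm i) (σ.symm j) with hle | hle
  · simpa using key _ _ hle (by simpa using hij)
  · simpa using (key _ _ hle (by simpa using hij.symm)).symm

lemma internalPart_congr_gap (hm : ∀ i, 0 < m i) {P : Cluster (d + 1)}
    {q q' : Fin (d + 1) → ℝ} (h : ∀ k ∈ enclosed σ P, gap σ q k = gap σ q' k) :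
    internalPart m P q = internalPart m P q' := by
  rw [← sub_eq_zero, ← internalPart_sub]
  refine internalPart_eq_zero_of_gap σ hm fun k hk => ?_
  rw [map_sub, Pi.sub_apply, h k hk, sub_self]

lemma gap_eq_zero_of_internalPart {P : Cluster (d + 1)} {q : Fin (d + 1) → ℝ}
    (h0 : ∀ k ∈ enclosed σ P, 0 ≤ gap σ q k) (h : internalPart m P q = 0) :
    ∀ k ∈ enclosed σ P, gap σ q k = 0 := by
  rintro k ⟨a, b, hp, h1, h2⟩
  have hab := const_of_internalPart_eq_zero h hp
  have e1 := le_of_gap_nonneg σ (q := q) h1 fun l l1 l2 => h0 l ⟨a, b, hp, l1, l2.trans h2⟩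
  have e2 := le_of_gap_nonneg σ (q := q) (Fin.castSucc_lt_iff_succ_le.mp h2) fun l l1 l2 =>
    h0 l ⟨a, b, hp, h1.trans (Fin.castSucc_lt_succ.le.trans l1), l2⟩
  have e3 := h0 k ⟨a, b, hp, h1, h2⟩
  rw [gap_apply] at e3 ⊢
  linarith

open Classical in
/-- The cluster decomposition in which the particles on both sides of each gap in `A` are joined.
Two particles are in the same atom if equally many gaps outside `A` lie to the left of them. -/
def gapCluster (A : Set (Fin d)) : Cluster (d + 1) :=
  Finpartition.ofSetoid (Setoid.ker fun i : Fin (d + 1) =>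
    (Finset.univ.filter fun k : Fin d => k ∉ A ∧ k.castSucc < σ.symm i).card)

open Classical in
lemma gapCluster_part_eq (A : Set (Fin d)) (i j : Fin (d + 1)) :
    (gapCluster σ A).part i = (gapCluster σ A).part j ↔
    (Finset.univ.filter fun k : Fin d => k ∉ A ∧ k.castSucc < σ.symm i).card =
    (Finset.univ.filter fun k : Fin d => k ∉ A ∧ k.castSucc < σ.symm j).card := by
  rw [← Finpartition.mem_part_iff_part_eq_part _ (Finset.mem_univ i) (Finset.mem_univ j)]
  rw [gapCluster, Finpartition.mem_part_ofSetoid_iff_rel, Setoid.ker_def]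
  exact eq_comm

lemma gapCluster_part_succ {A : Set (Fin d)} {k : Fin d} (hk : k ∈ A) :
    (gapCluster σ A).part (σ k.castSucc) = (gapCluster σ A).part (σ k.succ) := by
  rw [gapCluster_part_eq]
  congr 1
  ext l
  simp only [Finset.mem_filter, Finset.mem_univ, true_and, Equiv.symm_apply_apply]
  refine and_congr_right fun hl => ⟨fun h => h.trans Fin.castSucc_lt_succ, fun h => ?_⟩
  have hne : l ≠ k := fun h => hl (h ▸ hk)
  rw [Fin.castSucc_lt_castSucc_iff]
  exact lt_of_le_of_ne (Fin.castSucc_lt_succ_iff.mp h) hne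

lemma enclosed_gapCluster (A : Set (Fin d)) : enclosed σ (gapCluster σ A) = A := by
  ext k
  refine ⟨fun ⟨a, b, hp, h1, h2⟩ => ?_, fun hk =>
    ⟨k.castSucc, k.succ, gapCluster_part_succ σ hk, le_rfl, Fin.castSucc_lt_succ⟩⟩
  by_contra hk
  rw [gapCluster_part_eq] at hp
  refine (Finset.card_lt_card ?_).ne hp
  refine Finset.ssubset_iff_subset_ne.mpr ⟨fun l hl => ?_, fun he => ?_⟩
  · simp only [Finset.mem_filter, Finset.mem_univ, true_and, Equiv.symm_apply_apply] at hl ⊢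
    exact ⟨hl.1, hl.2.trans (h1.trans_lt h2)⟩
  · have hmem := Finset.ext_iff.mp he k
    simp only [Finset.mem_filter, Finset.mem_univ, true_and, Equiv.symm_apply_apply] at hmem
    exact absurd (hmem.mpr ⟨hk, h2⟩).2 (not_lt.mpr h1)

lemma gapCluster_ne_bot {A : Set (Fin d)} (hA : A.Nonempty) : gapCluster σ A ≠ ⊥ := by
  obtain ⟨k, hk⟩ := hA
  intro h
  have h1 := gapCluster_part_succ σ hk
  rw [h, ← Finpartition.mem_part_iff_part_eq_part _ (Finset.mem_univ _) (Finset.mem_univ _)] at h1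
  have h2 := (⊥ : Cluster (d + 1)).part_mem.mpr (Finset.mem_univ (σ k.succ))
  obtain ⟨a, -, ha⟩ := Finpartition.mem_bot_iff.mp h2
  have h3 := (⊥ : Cluster (d + 1)).mem_part (Finset.mem_univ (σ k.succ))
  rw [← ha, Finset.mem_singleton] at h1 h3
  have := σ.injective (h1.trans h3.symm)
  exact absurd this (Fin.castSucc_lt_succ).ne

/-- `gapCluster` as a cluster decomposition other than the finest one. -/
def gapCollision {A : Set (Fin d)} (hA : A.Nonempty) : CollisionCluster (d + 1) :=
  ⟨gapCluster σ A, gapCluster_ne_bot σ hA⟩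

lemma enclosed_nonempty (P : CollisionCluster (d + 1)) : (enclosed σ P.1).Nonempty := by
  obtain ⟨i, j, hij, hp⟩ := exists_ne_of_ne_bot P.2
  have key : ∀ a b : Fin (d + 1), a < b → P.1.part (σ a) = P.1.part (σ b) →
      (enclosed σ P.1).Nonempty := fun a b hab h => by
    have hne : a ≠ Fin.last d := (hab.trans_le (Fin.le_last b)).ne
    exact ⟨a.castPred hne, a, b, h, by simp, by simpa using hab⟩
  rcases lt_or_gt_of_ne (σ.symm.injective.ne hij) with h | h
  · exact key _ _ h (by simpa using hp)
  · exact key _ _ h (by simpa using hp.symm)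

/-- The projection to the barycentres of the atoms does not change the gaps in `A`. -/
lemma gap_internalPart_gapCluster {A : Set (Fin d)} (q : Fin (d + 1) → ℝ) {k : Fin d}
    (hk : k ∈ A) : gap σ (internalPart m (gapCluster σ A) q) k = gap σ q k := by
  simp only [gap_apply, internalPart, Pi.sub_apply,
    externalPart_const (gapCluster σ A) q (gapCluster_part_succ σ hk)]
  ring

variable (m) in
/-- The configuration with centre of mass zero and prescribed gaps. -/
def config : (Fin d → ℝ) →ₗ[ℝ] (Fin (d + 1) → ℝ) :=
  internalLinear m ⊤ ∘ₗ LinearMap.pi fun i => ∑ k with k.castSucc < σ.symm i, LinearMap.proj k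

lemma config_apply (x : Fin d → ℝ) :
    config m σ x = internalPart m ⊤ fun i => ∑ k with k.castSucc < σ.symm i, x k := by
  simp only [config, LinearMap.comp_apply]
  change internalPart m ⊤ _ = _
  congr 1
  ext i
  simp

lemma contDiff_config : ContDiff ℝ ∞ (config m σ) := (config m σ).toContinuousLinearMap.contDiff

lemma config_mem (hm : ∀ i, 0 < m i) (x : Fin d → ℝ) : config m σ x ∈ configSpace m := by
  rw [config_apply]
  exact internalPart_mem_configSpace hm _ _

lemma gap_config (x : Fin d → ℝ) : gap σ (config m σ x) = x := by
  ext l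
  have hpart : (⊤ : Cluster (d + 1)).part (σ l.succ) = (⊤ : Cluster (d + 1)).part (σ l.castSucc) :=
    Finpartition.parts_top_subsingleton (Finset.univ : Finset (Fin (d + 1)))
      ((⊤ : Cluster (d + 1)).part_mem.mpr (Finset.mem_univ _))
      ((⊤ : Cluster (d + 1)).part_mem.mpr (Finset.mem_univ _))
  rw [config_apply, gap_apply]
  simp only [internalPart, Pi.sub_apply, externalPart_const _ _ hpart, Equiv.symm_apply_apply]
  have : (Finset.univ.filter fun k : Fin d => k.castSucc < l.succ) =
      insert l (Finset.univ.filter fun k : Fin d => k.castSucc < l.castSucc) := by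
    ext k
    simp only [Finset.mem_filter, Finset.mem_univ, true_and, Finset.mem_insert,
      Fin.castSucc_lt_castSucc_iff, Fin.castSucc_lt_succ_iff]
    exact le_iff_eq_or_lt
  rw [this, Finset.sum_insert (by simp)]
  ring

lemma eq_of_gap_eq (hm : ∀ i, 0 < m i) {q q' : Fin (d + 1) → ℝ} (hq : q ∈ configSpace m)
    (hq' : q' ∈ configSpace m) (h : gap σ q = gap σ q') : q = q' := by
  have hpart : ∀ i j, (⊤ : Cluster (d + 1)).part i = (⊤ : Cluster (d + 1)).part j := fun i j =>
    Finpartition.parts_top_subsingleton (Finset.univ : Finset (Fin (d + 1)))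
      ((⊤ : Cluster (d + 1)).part_mem.mpr (Finset.mem_univ _))
      ((⊤ : Cluster (d + 1)).part_mem.mpr (Finset.mem_univ _))
  have h0 : internalPart m ⊤ (q - q') = 0 := internalPart_eq_zero_of_gap σ hm fun k _ => by
    rw [map_sub, h, sub_self, Pi.zero_apply]
  have hmem' : q - q' ∈ configSpace m := (configSpace (E := ℝ) m).sub_mem hq hq'
  have hmem : ∑ i, m i • (q - q') i = 0 := hmem'
  rw [← sub_eq_zero]
  ext j
  simp only [fun i => const_of_internalPart_eq_zero h0 (hpart i j), smul_eq_mul,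
    ← Finset.sum_mul] at hmem
  exact (mul_eq_zero.mp hmem).resolve_left (Finset.sum_pos (fun i _ => hm i) ⟨j, by simp⟩).ne'

lemma config_gap (hm : ∀ i, 0 < m i) {q : Fin (d + 1) → ℝ} (hq : q ∈ configSpace m) :
    config m σ (gap σ q) = q :=
  eq_of_gap_eq σ hm (config_mem σ hm _) hq (gap_config σ _)

end Gaps

end NBody

namespace NBody

open Filter Topology RatioSpace

/-! ### The closure of a chamber in the blow-up -/

section ChamberBlowUp

variable {d : ℕ} {m : Fin (d + 1) → ℝ} (σ : Equiv.Perm (Fin (d + 1)))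

variable (m) in
/-- The closure of the image of a chamber in the blow-up. -/
def chamberBlowUp : Set (Ambient (d + 1) ℝ) := closure (diagonalMap m '' chamber m σ)

lemma chamberBlowUp_subset : chamberBlowUp m σ ⊆ graphBlowUp m :=
  closure_mono (Set.image_mono (chamber_subset_noncollision σ))

lemma diagonalMap_mem_chamberBlowUp {q : Fin (d + 1) → ℝ} (hq : q ∈ chamber m σ) :
    diagonalMap m q ∈ chamberBlowUp m σ := subset_closure ⟨q, hq, rfl⟩

variable {y y' : Ambient (d + 1) ℝ}

lemma gap_position_nonneg (hm : ∀ i, 0 < m i) (P₀ : CollisionCluster (d + 1))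
    (hy : y ∈ chamberBlowUp m σ) (k : Fin d) : 0 ≤ gap σ (position P₀ y) k := by
  have hcl : IsClosed {y : Ambient (d + 1) ℝ | 0 ≤ gap σ (position P₀ y) k} :=
    isClosed_le continuous_const ((continuous_apply k).comp
      ((contDiff_gap σ).continuous.comp (contDiff_position P₀).continuous))
  refine closure_minimal ?_ hcl hy
  rintro _ ⟨q, hq, rfl⟩
  simp only [Set.mem_ofPred_eq, position_diagonalMap hm]
  exact (((mem_chamber σ).mp hq).2 k).le

lemma gap_unitPart_gapCluster {A : Set (Fin d)} (q : Fin (d + 1) → ℝ)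
    {k : Fin d} (hk : k ∈ A) : gap σ (unitPart m (gapCluster σ A) q) k =
      (internalRadius m (gapCluster σ A) q)⁻¹ * gap σ q k := by
  rw [unitPart, map_smul, Pi.smul_apply, gap_internalPart_gapCluster σ q hk, smul_eq_mul]

lemma continuous_gap_snd (P : CollisionCluster (d + 1)) (k : Fin d) :
    Continuous fun y : Ambient (d + 1) ℝ => gap σ (y P).2.2 k :=
  (continuous_apply k).comp ((contDiff_gap σ).continuous.comp (by fun_prop))

lemma gap_snd_nonneg {A : Set (Fin d)} (hA : A.Nonempty)
    (hy : y ∈ chamberBlowUp m σ) {k : Fin d} (hk : k ∈ A) :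
    0 ≤ gap σ (y (gapCollision σ hA)).2.2 k := by
  have hcl : IsClosed {y : Ambient (d + 1) ℝ | 0 ≤ gap σ (y (gapCollision σ hA)).2.2 k} :=
    isClosed_le continuous_const (continuous_gap_snd σ _ k)
  refine closure_minimal ?_ hcl hy
  rintro _ ⟨q, hq, rfl⟩
  simp only [Set.mem_ofPred_eq, diagonalMap_eq, gapCollision, gap_unitPart_gapCluster σ q hk]
  exact mul_nonneg (inv_nonneg.mpr (internalRadius_nonneg _ _)) (((mem_chamber σ).mp hq).2 k).le

lemma exists_gap_snd_pos (hm : ∀ i, 0 < m i) {A : Set (Fin d)} (hA : A.Nonempty)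
    (hy : y ∈ chamberBlowUp m σ) : ∃ k ∈ A, 0 < gap σ (y (gapCollision σ hA)).2.2 k := by
  by_contra! h
  have hyX := chamberBlowUp_subset σ hy
  refine snd_ne_zero_of_mem hm hyX (gapCollision σ hA) ?_
  rw [← ((graphBlowUp_props hm (gapCollision σ hA) hyX).2 (gapCollision σ hA)).2.2.2.1]
  refine internalPart_eq_zero_of_gap σ hm fun k hk => ?_
  rw [gapCollision, enclosed_gapCluster] at hk
  exact le_antisymm (h k hk) (gap_snd_nonneg σ hA hy hk)

lemma internalPart_snd_ne_zero (hm : ∀ i, 0 < m i) (P : CollisionCluster (d + 1))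
    (hy : y ∈ chamberBlowUp m σ) :
    internalPart m P.1 (y (gapCollision σ (enclosed_nonempty σ P))).2.2 ≠ 0 := fun h => by
  obtain ⟨k, hk, hpos⟩ := exists_gap_snd_pos σ hm (enclosed_nonempty σ P) hy
  exact hpos.ne' (gap_eq_zero_of_internalPart σ (fun k hk => gap_snd_nonneg σ _ hy hk) h k hk)

/-- The direction at `P` is a function of the direction at the decomposition into intervals of
particles that encloses the same gaps as `P`. -/
lemma snd_eq_unitPart (hm : ∀ i, 0 < m i) (P : CollisionCluster (d + 1))
    (hy : y ∈ chamberBlowUp m σ) :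
    (y P).2.2 = unitPart m P.1 (y (gapCollision σ (enclosed_nonempty σ P))).2.2 := by
  refine Set.EqOn.of_subset_closure (s := diagonalMap m '' chamber m σ) (t := chamberBlowUp m σ)
    (f := fun y : Ambient (d + 1) ℝ => (y P).2.2) (g := fun y : Ambient (d + 1) ℝ =>
      unitPart m P.1 (y (gapCollision σ (enclosed_nonempty σ P))).2.2) ?_ (by fun_prop) ?_
    subset_closure subset_rfl hy
  · rintro _ ⟨q, hq, rfl⟩
    simp only [diagonalMap_eq, gapCollision]
    have hq' := injective_of_gap_pos ((mem_chamber σ).mp hq).2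
    have hR := (internalRadius_nonneg (m := m) (gapCluster σ (enclosed σ P.1)) q).lt_of_ne'
      (mt (internalRadius_eq_zero hm).mp (internalPart_ne_zero_of_injective hq'
        (gapCollision σ (enclosed_nonempty σ P))))
    rw [← unitPart_smul P.1 (inv_pos.mpr hR) q]
    refine unitPart_congr (internalPart_congr_gap σ hm fun k hk => ?_)
    rw [gap_unitPart_gapCluster σ q hk, map_smul, Pi.smul_apply, smul_eq_mul]
  · intro z hz
    have hc : Continuous fun y : Ambient (d + 1) ℝ =>
        (y (gapCollision σ (enclosed_nonempty σ P))).2.2 := by fun_prop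
    exact (hc.continuousAt.unitPart hm (internalPart_snd_ne_zero σ hm P hz)).continuousWithinAt

/-- The limit of the ratio `x i / (x i + x j)` of gaps at a point of the closure of the chamber. It
is read off from the direction at the cluster decomposition joining precisely the particles at the
gaps `i` and `j`. -/
def gapRatio (i j : Fin d) (y : Ambient (d + 1) ℝ) : ℝ :=
  gap σ (y (gapCollision σ (Set.insert_nonempty i {j}))).2.2 i /
    (gap σ (y (gapCollision σ (Set.insert_nonempty i {j}))).2.2 i +
      gap σ (y (gapCollision σ (Set.insert_nonempty i {j}))).2.2 j)

/-- The gaps and gap ratios of a point in the closure of the chamber. -/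
def ratioData (P₀ : CollisionCluster (d + 1)) (y : Ambient (d + 1) ℝ) : RatioData (Fin d) :=
  (gap σ (position P₀ y), fun i j => gapRatio σ i j y)

lemma continuousOn_gapRatio (hm : ∀ i, 0 < m i) (i j : Fin d) :
    ContinuousOn (gapRatio σ i j) (chamberBlowUp m σ) := by
  refine ContinuousOn.div (continuous_gap_snd σ _ i).continuousOn
    ((continuous_gap_snd σ _ i).add (continuous_gap_snd σ _ j)).continuousOn fun y hy => ?_
  obtain ⟨k, hk, hpos⟩ := exists_gap_snd_pos σ hm (Set.insert_nonempty i {j}) hy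
  have h1 := gap_snd_nonneg σ (Set.insert_nonempty i {j}) hy (k := i) (by simp)
  have h2 := gap_snd_nonneg σ (Set.insert_nonempty i {j}) hy (k := j) (by simp)
  rcases hk with rfl | rfl
  · exact (add_pos_of_pos_of_nonneg hpos h2).ne'
  · exact (add_pos_of_nonneg_of_pos h1 hpos).ne'

lemma continuous_gap_position (P₀ : CollisionCluster (d + 1)) :
    Continuous fun y : Ambient (d + 1) ℝ => gap σ (position P₀ y) :=
  (contDiff_gap σ).continuous.comp (contDiff_position P₀).continuous

lemma continuousOn_ratioData (hm : ∀ i, 0 < m i) (P₀ : CollisionCluster (d + 1)) :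
    ContinuousOn (ratioData σ P₀) (chamberBlowUp m σ) :=
  (continuous_gap_position σ P₀).continuousOn.prodMk
    (continuousOn_pi.mpr fun i => continuousOn_pi.mpr fun j => continuousOn_gapRatio σ hm i j)

lemma ratioData_diagonalMap (hm : ∀ i, 0 < m i) (P₀ : CollisionCluster (d + 1))
    {q : Fin (d + 1) → ℝ} (hq : ∀ k, 0 < gap σ q k) :
    ratioData σ P₀ (diagonalMap m q) = ratioMap (gap σ q) := by
  refine Prod.ext (by simp only [ratioData, position_diagonalMap hm, ratioMap])
    (funext fun i => funext fun j => ?_)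
  have hR := mt (internalRadius_eq_zero hm).mp (internalPart_ne_zero_of_injective (m := m)
    (injective_of_gap_pos hq) (gapCollision σ (Set.insert_nonempty i {j})))
  simp only [gapCollision] at hR
  simp only [ratioData, gapRatio, diagonalMap_eq, gapCollision, ratioMap,
    gap_unitPart_gapCluster σ q (Set.mem_insert i {j}),
    gap_unitPart_gapCluster σ q (Set.mem_insert_of_mem i (Set.mem_singleton j)), ← mul_add]
  exact mul_div_mul_left _ _ (inv_ne_zero hR)

lemma ratioData_mem (hm : ∀ i, 0 < m i) (P₀ : CollisionCluster (d + 1))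
    (hy : y ∈ chamberBlowUp m σ) : ratioData σ P₀ y ∈ ratioSpace (Fin d) := by
  refine closure_mono ?_ ((continuousOn_ratioData σ hm P₀).image_closure ⟨y, hy, rfl⟩)
  rintro _ ⟨_, ⟨q, hq, rfl⟩, rfl⟩
  have hq' := ((mem_chamber σ).mp hq).2
  exact ⟨gap σ q, hq', (ratioData_diagonalMap σ hm P₀ hq').symm⟩

lemma gapRatio_mul (hm : ∀ i, 0 < m i) {A : Set (Fin d)} (hA : A.Nonempty)
    (hy : y ∈ chamberBlowUp m σ) {i j : Fin d} (hi : i ∈ A) (hj : j ∈ A) :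
    gapRatio σ i j y * (gap σ (y (gapCollision σ hA)).2.2 i +
      gap σ (y (gapCollision σ hA)).2.2 j) = gap σ (y (gapCollision σ hA)).2.2 i := by
  refine Set.EqOn.of_subset_closure (s := diagonalMap m '' chamber m σ) (t := chamberBlowUp m σ)
    (f := fun y => gapRatio σ i j y * (gap σ (y (gapCollision σ hA)).2.2 i +
      gap σ (y (gapCollision σ hA)).2.2 j)) (g := fun y => gap σ (y (gapCollision σ hA)).2.2 i) ?_
    ((continuousOn_gapRatio σ hm i j).mul ((continuous_gap_snd σ _ i).add
      (continuous_gap_snd σ _ j)).continuousOn) (continuous_gap_snd σ _ i).continuousOn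
    subset_closure subset_rfl hy
  rintro _ ⟨q, hq, rfl⟩
  have hq' := ((mem_chamber σ).mp hq).2
  have h1 : gapRatio σ i j (diagonalMap m q) = gap σ q i / (gap σ q i + gap σ q j) :=
    congrFun (congrFun (congrArg Prod.snd
      (ratioData_diagonalMap σ hm (gapCollision σ hA) hq')) i) j
  simp only [h1, diagonalMap_eq, gapCollision, gap_unitPart_gapCluster σ q hi,
    gap_unitPart_gapCluster σ q hj]
  have := hq' i
  have := hq' j
  field_simp

/-- On `A`, the gaps of the direction at `gapCluster σ A` are determined by their ratios to one of
them that does not vanish, up to a positive factor that normalisation removes. -/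
theorem ratioData_injOn (hm : ∀ i, 0 < m i) (P₀ : CollisionCluster (d + 1))
    (hy : y ∈ chamberBlowUp m σ) (hy' : y' ∈ chamberBlowUp m σ)
    (h : ratioData σ P₀ y = ratioData σ P₀ y') : y = y' := by
  have hp := graphBlowUp_props hm P₀ (chamberBlowUp_subset σ hy)
  have hp' := graphBlowUp_props hm P₀ (chamberBlowUp_subset σ hy')
  have hpos : position P₀ y = position P₀ y' :=
    eq_of_gap_eq σ hm hp.1 hp'.1 (congrArg Prod.fst h)
  funext P
  refine Prod.ext (by rw [(hp.2 P).1, (hp'.2 P).1, hpos])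
    (Prod.ext (by rw [(hp.2 P).2.1, (hp'.2 P).2.1, hpos]) ?_)
  rw [snd_eq_unitPart σ hm P hy, snd_eq_unitPart σ hm P hy']
  have hA := enclosed_nonempty σ P
  obtain ⟨i, hi, hgi⟩ := exists_gap_snd_pos σ hm hA hy
  obtain ⟨l, hl, hgl⟩ := exists_gap_snd_pos σ hm hA hy'
  have hθ : ∀ j, gapRatio σ i j y = gapRatio σ i j y' := fun j =>
    congrFun (congrFun (congrArg Prod.snd h) i) j
  have hne : ∀ j ∈ enclosed σ P.1, gapRatio σ i j y ≠ 0 := fun j hj h0 => by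
    have := gapRatio_mul σ hm hA hy hi hj
    rw [h0, zero_mul] at this
    exact hgi.ne this
  have hgi' : 0 < gap σ (y' (gapCollision σ hA)).2.2 i := by
    refine (gap_snd_nonneg σ hA hy' hi).lt_of_ne fun h0 => ?_
    have := gapRatio_mul σ hm hA hy' hi hl
    rw [← h0, zero_add, ← hθ] at this
    exact (mul_eq_zero.mp this).elim (hne l hl) hgl.ne'
  have hc := div_pos hgi hgi'
  rw [← unitPart_smul P.1 hc (y' (gapCollision σ hA)).2.2]
  refine unitPart_congr (internalPart_congr_gap σ hm fun j hj => ?_)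
  rw [map_smul, Pi.smul_apply, smul_eq_mul, div_mul_eq_mul_div, eq_div_iff hgi'.ne']
  have e1 := gapRatio_mul σ hm hA hy hi hj
  have e2 := gapRatio_mul σ hm hA hy' hi hj
  rw [← hθ] at e2
  refine mul_left_cancel₀ (hne j hj) ?_
  linear_combination (gap σ (y' (gapCollision σ hA)).2.2 i) * e1 -
    (gap σ (y (gapCollision σ hA)).2.2 i) * e2

lemma isCompact_massSphere {n : ℕ} {m : Fin n → ℝ} (hm : ∀ i, 0 < m i) :
    IsCompact {u : Fin n → ℝ | massInner m u u = 1} := by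
  refine (isCompact_univ_pi fun i => isCompact_Icc (a := -(1 + 1 / m i)) (b := 1 + 1 / m i)
    ).of_isClosed_subset (isClosed_eq (contDiff_massInner_self (m := m)).continuous
      continuous_const) fun u hu i _ => ?_
  rw [Set.mem_ofPred_eq, massInner_real] at hu
  have h1 := Finset.single_le_sum (f := fun i => m i * (u i * u i))
    (fun i _ => mul_nonneg (hm i).le (mul_self_nonneg (u i))) (Finset.mem_univ i)
  rw [hu] at h1
  have h2 : u i * u i ≤ 1 / m i := by rw [le_div_iff₀ (hm i)]; linarith
  exact ⟨by nlinarith [sq_nonneg (u i + 1)], by nlinarith [sq_nonneg (u i - 1)]⟩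

lemma isCompact_chamberBlowUp_le (hm : ∀ i, 0 < m i) (P₀ : CollisionCluster (d + 1)) (C : ℝ) :
    IsCompact {y | y ∈ chamberBlowUp m σ ∧ ∀ k, gap σ (position P₀ y) k ≤ C} := by
  set K : Set (Fin (d + 1) → ℝ) := config m σ '' Set.pi Set.univ fun _ => Set.Icc 0 C
  have hK : IsCompact K := (isCompact_univ_pi fun _ => isCompact_Icc).image
    (contDiff_config σ).continuous
  refine (isCompact_univ_pi fun P : CollisionCluster (d + 1) =>
    (hK.image (contDiff_externalPart (m := m) P.1).continuous).prod
      ((hK.image (continuous_internalRadius (m := m) P.1)).prod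
        (isCompact_massSphere hm))).of_isClosed_subset ?_ ?_
  · have hcl : IsClosed {y : Ambient (d + 1) ℝ | ∀ k, gap σ (position P₀ y) k ≤ C} := by
      simp only [Set.ofPred_forall]
      exact isClosed_iInter fun k => isClosed_le
        ((continuous_apply k).comp (continuous_gap_position σ P₀)) continuous_const
    exact isClosed_closure.inter hcl
  · rintro y ⟨hy, hle⟩ P -
    obtain ⟨hmem, hp⟩ := graphBlowUp_props hm P₀ (chamberBlowUp_subset σ hy)
    have hposK : position P₀ y ∈ K :=
      ⟨gap σ (position P₀ y), fun k _ => ⟨gap_position_nonneg σ hm P₀ hy k, hle k⟩,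
        config_gap σ hm hmem⟩
    obtain ⟨h1, h2, -, -, h3⟩ := hp P
    exact ⟨⟨_, hposK, h1.symm⟩, ⟨_, hposK, h2.symm⟩, h3⟩

variable (m) in
/-- The points in the closure of the chamber where particles collide. The choice of `P₀` does not
matter. -/
def chamberBoundary (P₀ : CollisionCluster (d + 1)) : Set (Ambient (d + 1) ℝ) :=
  {y | y ∈ chamberBlowUp m σ ∧ ∃ k, gap σ (position P₀ y) k = 0}

lemma isClosed_chamberBoundary (P₀ : CollisionCluster (d + 1)) :
    IsClosed (chamberBoundary m σ P₀) := by
  have hcl : IsClosed {y : Ambient (d + 1) ℝ | ∃ k, gap σ (position P₀ y) k = 0} := by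
    simp only [Set.ofPred_exists]
    exact isClosed_iUnion_of_finite fun k => isClosed_eq
      ((continuous_apply k).comp (continuous_gap_position σ P₀)) continuous_const
  exact isClosed_closure.inter hcl

end ChamberBlowUp

/-! ### The collision part of a chamber closure is a Euclidean space -/

section Homeomorphism

variable {d : ℕ} {m : Fin (d + 2) → ℝ} (σ : Equiv.Perm (Fin (d + 2)))

/-- The moment of the gap ratios modulo constant vectors, in the coordinates `v (a + 1) - v 0`. -/
def momentCoord (P₀ : CollisionCluster (d + 2)) (y : Ambient (d + 2) ℝ) :
    EuclideanSpace ℝ (Fin d) :=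
  WithLp.toLp 2 fun a => moment (ratioData σ P₀ y) a.succ - moment (ratioData σ P₀ y) 0

lemma continuousOn_momentCoord (hm : ∀ i, 0 < m i) (P₀ : CollisionCluster (d + 2)) :
    ContinuousOn (momentCoord σ P₀) (chamberBlowUp m σ) :=
  (PiLp.continuous_toLp 2 _).comp_continuousOn (continuousOn_pi.mpr fun a =>
    ((continuous_moment a.succ).comp_continuousOn (continuousOn_ratioData σ hm P₀)).sub
      ((continuous_moment 0).comp_continuousOn (continuousOn_ratioData σ hm P₀)))

lemma momentCoord_injOn (hm : ∀ i, 0 < m i) (P₀ : CollisionCluster (d + 2)) :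
    Set.InjOn (momentCoord σ P₀) (chamberBoundary m σ P₀) := by
  intro y ⟨hy, hy0⟩ y' ⟨hy', hy0'⟩ h
  refine ratioData_injOn σ hm P₀ hy hy' (moment_injOn_boundary (ratioData_mem σ hm P₀ hy)
    (ratioData_mem σ hm P₀ hy') hy0 hy0'
    (t := moment (ratioData σ P₀ y) 0 - moment (ratioData σ P₀ y') 0) fun i => ?_)
  cases i using Fin.cases with
  | zero => ring
  | succ a =>
    have : moment (ratioData σ P₀ y) a.succ - moment (ratioData σ P₀ y) 0 =
      moment (ratioData σ P₀ y') a.succ - moment (ratioData σ P₀ y') 0 := congrArg (fun v => v a) h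
    linarith

/-- Points of the chamber with the given value of `momentCoord` and product of gaps `exp (-N)` stay
in a compact set and accumulate, as `N → ∞`, at a point with a vanishing gap. -/
lemma momentCoord_surjOn (hm : ∀ i, 0 < m i) (P₀ : CollisionCluster (d + 2)) :
    Set.SurjOn (momentCoord σ P₀) (chamberBoundary m σ P₀) Set.univ := by
  intro v _
  set h : Fin (d + 1) → ℝ := Fin.cons 0 v with hh
  have hex := fun N : ℕ => exists_moment_eq h (-(N : ℝ))
  choose x hx hprod t ht using hex
  have hmem : ∀ N, config m σ (x N) ∈ chamber m σ := fun N =>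
    (mem_chamber σ).mpr ⟨config_mem σ hm _, by rw [gap_config]; exact hx N⟩
  set C : ℝ := 1 + (d + 1) + 2 * ∑ i, |h i| with hC
  have hh' : ∀ i, |h i| ≤ ∑ i, |h i| := fun i =>
    Finset.single_le_sum (fun i _ => abs_nonneg (h i)) (Finset.mem_univ i)
  have hle : ∀ N k, x N k ≤ C := fun N k => by
    obtain ⟨i, hi⟩ : ∃ i, x N i ≤ 1 := by
      by_contra! hlt
      have h1 : ∏ _i : Fin (d + 1), (1 : ℝ) < ∏ i, x N i := Finset.prod_lt_prod_of_nonempty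
        (fun _ _ => one_pos) (fun i _ => hlt i) Finset.univ_nonempty
      rw [hprod, Finset.prod_const_one] at h1
      exact h1.not_ge (Real.exp_le_one_iff.mpr (by simp))
    have hr : ratioMap (x N) ∈ ratioSpace (Fin (d + 1)) := subset_closure ⟨x N, hx N, rfl⟩
    have h1 := moment_le_card hr i
    have h2 := le_moment hr k
    rw [ht] at h1 h2
    simp only [ratioMap, Fintype.card_fin, Nat.cast_add, Nat.cast_one] at h1 h2
    have h3 := neg_abs_le (h i)
    have h4 := le_abs_self (h k)
    linarith [hh' i, hh' k]
  obtain ⟨y, ⟨hy, -⟩, s, hs, hlim⟩ := (isCompact_chamberBlowUp_le σ hm P₀ C).tendsto_subseq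
    (x := fun N => diagonalMap m (config m σ (x N))) fun N =>
      ⟨diagonalMap_mem_chamberBlowUp σ (hmem N), fun k => by
        rw [position_diagonalMap hm, gap_config]; exact hle N k⟩
  refine ⟨y, ⟨hy, ?_⟩, ?_⟩
  · have h1 : Tendsto (fun N => ∏ k, gap σ (position P₀ (diagonalMap m (config m σ (x (s N))))) k)
        atTop (𝓝 (∏ k, gap σ (position P₀ y) k)) :=
      ((continuous_finsetProd _ fun k _ => (continuous_apply k).comp
        (continuous_gap_position σ P₀)).tendsto y).comp hlim
    simp only [position_diagonalMap hm, gap_config, hprod] at h1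
    have h2 : Tendsto (fun N => Real.exp (-(s N : ℝ))) atTop (𝓝 0) :=
      (Real.tendsto_exp_neg_atTop_nhds_zero.comp tendsto_natCast_atTop_atTop).comp hs.tendsto_atTop
    obtain ⟨k, -, hk⟩ := Finset.prod_eq_zero_iff.mp (tendsto_nhds_unique h1 h2)
    exact ⟨k, hk⟩
  · have h1 := (continuousOn_momentCoord σ hm P₀ y hy).tendsto.comp
      (tendsto_nhdsWithin_iff.mpr ⟨hlim, Eventually.of_forall fun N =>
        diagonalMap_mem_chamberBlowUp σ (hmem (s N))⟩)
    refine tendsto_nhds_unique h1 (tendsto_const_nhds.congr fun N => ?_)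
    ext a
    have hg : ∀ k, 0 < gap σ (config m σ (x (s N))) k := ((mem_chamber σ).mp (hmem _)).2
    simp only [Function.comp_apply, momentCoord, ratioData_diagonalMap σ hm P₀ hg, gap_config, ht,
      hh, Fin.cons_succ, Fin.cons_zero]
    ring

/-- A vanishing gap has bounded moment, so that `momentCoord` controls all gaps. -/
lemma gap_position_le (hm : ∀ i, 0 < m i) (P₀ : CollisionCluster (d + 2))
    {y : Ambient (d + 2) ℝ} (hy : y ∈ chamberBoundary m σ P₀) (k : Fin (d + 1)) :
    gap σ (position P₀ y) k ≤ (d + 1) + 2 * ‖momentCoord σ P₀ y‖ := by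
  obtain ⟨hy, i, hi⟩ := hy
  have hr := ratioData_mem σ hm P₀ hy
  have key : ∀ i, |moment (ratioData σ P₀ y) i - moment (ratioData σ P₀ y) 0| ≤
      ‖momentCoord σ P₀ y‖ := fun i => by
    cases i using Fin.cases with
    | zero => simp
    | succ a => exact PiLp.norm_apply_le (momentCoord σ P₀ y) a
  have h1 := moment_le_card hr i
  have h2 : gap σ (position P₀ y) k ≤ moment (ratioData σ P₀ y) k := le_moment hr k
  rw [show (ratioData σ P₀ y).1 i = 0 from hi, zero_add, Fintype.card_fin] at h1
  push_cast at h1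
  linarith [(abs_le.mp (key i)).1, (abs_le.mp (key k)).2]

theorem isProperMap_momentCoord (hm : ∀ i, 0 < m i) (P₀ : CollisionCluster (d + 2)) :
    IsProperMap fun y : chamberBoundary m σ P₀ => momentCoord σ P₀ y := by
  have hc : Continuous fun y : chamberBoundary m σ P₀ => momentCoord σ P₀ y :=
    ((continuousOn_momentCoord σ hm P₀).mono fun _ hy => hy.1).domRestrict
  refine isProperMap_iff_isCompact_preimage.mpr ⟨hc, fun K hK => ?_⟩
  obtain ⟨R, hR⟩ := hK.isBounded.exists_norm_le
  refine ((isClosed_chamberBoundary σ P₀).isClosedEmbedding_subtypeVal.isCompact_preimage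
    (isCompact_chamberBlowUp_le σ hm P₀ ((d + 1) + 2 * R))).of_isClosed_subset
    (hK.isClosed.preimage hc) fun y hy => ⟨y.2.1, fun k => ?_⟩
  exact (gap_position_le σ hm P₀ y.2 k).trans (by linarith [hR _ hy])

/-- `momentCoord` as a homeomorphism. -/
def chamberBoundaryHomeomorph (hm : ∀ i, 0 < m i) (P₀ : CollisionCluster (d + 2)) :
    chamberBoundary m σ P₀ ≃ₜ EuclideanSpace ℝ (Fin d) :=
  (Equiv.ofBijective (fun y : chamberBoundary m σ P₀ => momentCoord σ P₀ y)
    ⟨fun y y' h => Subtype.ext (momentCoord_injOn σ hm P₀ y.2 y'.2 h), fun v => by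
      obtain ⟨y, hy, h⟩ := momentCoord_surjOn σ hm P₀ (Set.mem_univ v)
      exact ⟨⟨y, hy⟩, h⟩⟩).toHomeomorphOfContinuousClosed
    (isProperMap_momentCoord σ hm P₀).continuous (isProperMap_momentCoord σ hm P₀).isClosedMap

end Homeomorphism

end NBody

namespace NBody

open Filter Topology RatioSpace

/-! ### Noncollision configurations are interior points -/

section Interior

variable {d : ℕ} {m : Fin (d + 1) → ℝ} (σ : Equiv.Perm (Fin (d + 1)))

/-- A vanishing boundary coordinate of a chart, composed with the parametrisation of the chamber by
gaps, has a local minimum. Its derivative would vanish, but a chart composed with a parametrisation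
has bijective derivative. -/
lemma diagonalMap_notMem_stratum (hm : ∀ i, 0 < m i) {q : Fin (d + 1) → ℝ}
    (hq : q ∈ chamber m σ) : diagonalMap m q ∉ Corner.stratum (graphBlowUp (E := ℝ) m) d 1 := by
  rintro ⟨c, hp, hcard⟩
  obtain ⟨i, hik, hi⟩ := Set.nonempty_of_ncard_ne_zero (hcard.trans_ne one_ne_zero)
  obtain ⟨O, hO, hsrc⟩ := c.source_open
  obtain ⟨O₁, g₁, hO₁, hs₁, hg₁, he₁⟩ := c.smooth
  obtain ⟨O₂, g₂, hO₂, hs₂, hg₂, he₂⟩ := c.smooth_inv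
  obtain ⟨O₃, hO₃, htgt⟩ := c.target_open
  have hgap := ((mem_chamber σ).mp hq).2
  set x₀ := gap σ q with hx₀
  set γ : (Fin d → ℝ) → Ambient (d + 1) ℝ := fun x => diagonalMap m (config m σ x) with hγdef
  have hγx : γ x₀ = diagonalMap m q := by simp only [hγdef, hx₀, config_gap σ hm hq.1]
  have hγ : ContDiffAt ℝ ∞ γ x₀ := by
    refine ContDiffAt.comp x₀ (g := diagonalMap m) ?_ (contDiff_config σ).contDiffAt
    rw [hx₀, config_gap σ hm hq.1]
    exact contDiffAt_diagonalMap hm (injective_of_gap_pos hgap)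
  have hev : ∀ᶠ x in 𝓝 x₀, γ x ∈ c.source := by
    have h1 : ∀ᶠ x in 𝓝 x₀, γ x ∈ O :=
      hγ.continuousAt.eventually_mem (hO.mem_nhds (by rw [hγx]; rw [hsrc] at hp; exact hp.2))
    have h2 : ∀ᶠ x in 𝓝 x₀, ∀ k, 0 < x k := eventually_all.mpr fun k =>
      (continuous_apply k).continuousAt.eventually (lt_mem_nhds (hgap k))
    filter_upwards [h1, h2] with x h1 h2
    rw [hsrc]
    exact ⟨chamberBlowUp_subset σ (diagonalMap_mem_chamberBlowUp σ
      ((mem_chamber σ).mpr ⟨config_mem σ hm x, by rwa [gap_config]⟩)), h1⟩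
  set f : (Fin d → ℝ) → EuclideanSpace ℝ (Fin d) := fun x => g₁ (γ x) with hf
  have hfx : f x₀ = c.toFun (diagonalMap m q) := by rw [hf, ← he₁ hp, ← hγx]
  have hfd : DifferentiableAt ℝ f x₀ := by
    have h1 : DifferentiableAt ℝ g₁ (γ x₀) :=
      (hg₁.contDiffAt (hO₁.mem_nhds (by rw [hγx]; exact hs₁ hp))).differentiableAt (by simp)
    exact h1.comp x₀ (hγ.differentiableAt (by simp))
  -- Any cluster decomposition serves to recover the configuration.
  set P₀ : CollisionCluster (d + 1) := gapCollision σ (Set.singleton_nonempty i)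
  set g : EuclideanSpace ℝ (Fin d) → Fin d → ℝ := fun z => gap σ (position P₀ (g₂ z)) with hg
  have hgd : DifferentiableAt ℝ g (f x₀) := by
    have h1 : DifferentiableAt ℝ g₂ (f x₀) :=
      (hg₂.contDiffAt (hO₂.mem_nhds (by rw [hfx]; exact hs₂ (c.mapsTo hp)))).differentiableAt
        (by simp)
    exact (((contDiff_gap σ).comp (contDiff_position P₀)).differentiable (by simp) _).comp _ h1
  have hgf : (fun x => g (f x)) =ᶠ[𝓝 x₀] id := by
    filter_upwards [hev] with x hx
    simp only [hg, hf, id]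
    rw [he₁ hx, he₂ (c.mapsTo hx), c.leftInv hx, position_diagonalMap hm, gap_config]
  have hcomp : (fderiv ℝ g (f x₀)).comp (fderiv ℝ f x₀) = ContinuousLinearMap.id ℝ _ :=
    (hgd.hasFDerivAt.comp x₀ hfd.hasFDerivAt).unique ((hasFDerivAt_id x₀).congr_of_eventuallyEq hgf)
  have hinj : Function.Injective (fderiv ℝ f x₀) := fun v w h => by
    have e1 := DFunLike.congr_fun hcomp v
    have e2 := DFunLike.congr_fun hcomp w
    simp only [ContinuousLinearMap.comp_apply, ContinuousLinearMap.id_apply] at e1 e2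
    rw [← e1, ← e2, h]
  have hsurj : Function.Surjective (fderiv ℝ f x₀) :=
    (LinearMap.injective_iff_surjective_of_finrank_eq_finrank
      (f := (fderiv ℝ f x₀ : (Fin d → ℝ) →ₗ[ℝ] EuclideanSpace ℝ (Fin d))) (by simp)).mp hinj
  have hmin : IsLocalMin (fun x => f x i) x₀ := by
    filter_upwards [hev] with x hx
    simp only [hfx, hi]
    have h1 := c.mapsTo hx
    rw [htgt] at h1
    simp only [hf]
    rw [he₁ hx]
    exact h1.1 i hik
  have hder : HasFDerivAt (fun x => f x i) ((EuclideanSpace.proj i).comp (fderiv ℝ f x₀)) x₀ :=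
    (EuclideanSpace.proj i : EuclideanSpace ℝ (Fin d) →L[ℝ] ℝ).hasFDerivAt.comp x₀ hfd.hasFDerivAt
  obtain ⟨v, hv⟩ := hsurj (EuclideanSpace.single i 1)
  have h0 := DFunLike.congr_fun (hmin.hasFDerivAt_eq_zero hder) v
  simp [hv] at h0

end Interior

/-! ### Collapsing a set of gaps -/

section Collapse

variable {d : ℕ} {m : Fin (d + 1) → ℝ} (σ : Equiv.Perm (Fin (d + 1))) (A : Set (Fin d))

open Classical in
/-- Multiplies the gaps in `A` by `t`. -/
def scaleGaps (t : ℝ) (x : Fin d → ℝ) : Fin d → ℝ := fun k => if k ∈ A then t * x k else x k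

variable (m) in
open Classical in
/-- The point of the blow-up above the configuration with gaps `scaleGaps A t x`. For `t > 0` it is
the image under the diagonal map (`collapse_of_pos`), and the formula extends this smoothly to
`t = 0`: if all gaps enclosed by `P` are in `A`, then `q^I_P` is proportional to `t`. -/
def collapse (t : ℝ) (x : Fin d → ℝ) : Ambient (d + 1) ℝ := fun P =>
  if enclosed σ P.1 ⊆ A then
    (externalPart m P.1 (config m σ (scaleGaps A t x)), t * internalRadius m P.1 (config m σ x),
      unitPart m P.1 (config m σ x))
  else diagonalMap m (config m σ (scaleGaps A t x)) P

lemma contDiff_scaleGaps : ContDiff ℝ ∞ fun p : ℝ × (Fin d → ℝ) => scaleGaps A p.1 p.2 := by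
  refine contDiff_pi.mpr fun k => ?_
  simp only [scaleGaps]
  split_ifs <;> fun_prop

lemma scaleGaps_nonneg {t : ℝ} (ht : 0 ≤ t) {x : Fin d → ℝ} (hx : ∀ k, 0 < x k) (k : Fin d) :
    0 ≤ scaleGaps A t x k := by
  have := hx k
  rw [scaleGaps]
  split_ifs <;> positivity

lemma scaleGaps_pos {t : ℝ} (ht : 0 < t) {x : Fin d → ℝ} (hx : ∀ k, 0 < x k) (k : Fin d) :
    0 < scaleGaps A t x k := by
  have := hx k
  rw [scaleGaps]
  split_ifs <;> positivity

lemma internalPart_scaleGaps (hm : ∀ i, 0 < m i) {P : Cluster (d + 1)} (hP : enclosed σ P ⊆ A)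
    (t : ℝ) (x : Fin d → ℝ) : internalPart m P (config m σ (scaleGaps A t x)) =
      internalPart m P (t • config m σ x) := by
  refine internalPart_congr_gap σ hm fun k hk => ?_
  rw [gap_config, map_smul, gap_config, scaleGaps, if_pos (hP hk), Pi.smul_apply, smul_eq_mul]

lemma collapse_of_pos (hm : ∀ i, 0 < m i) {t : ℝ} (ht : 0 < t) (x : Fin d → ℝ) :
    collapse m σ A t x = diagonalMap m (config m σ (scaleGaps A t x)) := by
  funext P
  rw [collapse]
  split_ifs with hP
  · have h := internalPart_scaleGaps σ A hm hP t x
    rw [diagonalMap_eq, internalRadius_congr h, unitPart_congr h, internalRadius_smul _ ht.le,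
      unitPart_smul _ ht]
  · rfl

lemma internalPart_config_ne_zero {x : Fin d → ℝ} (hx : ∀ k, 0 < x k)
    (P : CollisionCluster (d + 1)) : internalPart m P.1 (config m σ x) ≠ 0 :=
  internalPart_ne_zero_of_injective (injective_of_gap_pos (σ := σ) (by rwa [gap_config])) P

lemma internalPart_ne_zero_of_not_subset {q : Fin (d + 1) → ℝ} (h0 : ∀ k, 0 ≤ gap σ q k)
    (hA : ∀ k ∉ A, 0 < gap σ q k) {P : Cluster (d + 1)} (hP : ¬ enclosed σ P ⊆ A) :
    internalPart m P q ≠ 0 := fun h => by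
  obtain ⟨k, hk, hkA⟩ := Set.not_subset.mp hP
  exact (hA k hkA).ne' (gap_eq_zero_of_internalPart σ (fun k _ => h0 k) h k hk)

lemma internalPart_collapse_ne_zero {t : ℝ} (ht : 0 ≤ t) {x : Fin d → ℝ} (hx : ∀ k, 0 < x k)
    {P : Cluster (d + 1)} (hP : ¬ enclosed σ P ⊆ A) :
    internalPart m P (config m σ (scaleGaps A t x)) ≠ 0 := by
  refine internalPart_ne_zero_of_not_subset σ A ?_ ?_ hP
  · rw [gap_config]; exact scaleGaps_nonneg A ht hx
  · intro k hk
    rw [gap_config, scaleGaps, if_neg hk]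
    exact hx k

/-- The last hypothesis holds automatically for `t ≥ 0`; in this form `collapse` is also smooth on
a neighbourhood of `t = 0`, as a smooth inverse chart requires. -/
lemma contDiffAt_collapse (hm : ∀ i, 0 < m i) {p : ℝ × (Fin d → ℝ)} (hx : ∀ k, 0 < p.2 k)
    (hp : ∀ P : CollisionCluster (d + 1), ¬ enclosed σ P.1 ⊆ A →
      internalPart m P.1 (config m σ (scaleGaps A p.1 p.2)) ≠ 0) :
    ContDiffAt ℝ ∞ (fun p : ℝ × (Fin d → ℝ) => collapse m σ A p.1 p.2) p := by
  have hs : ContDiff ℝ ∞ fun p : ℝ × (Fin d → ℝ) => config m σ (scaleGaps A p.1 p.2) :=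
    (contDiff_config σ).comp (contDiff_scaleGaps A)
  refine contDiffAt_pi.mpr fun P => ?_
  simp only [collapse]
  split_ifs with hP
  · have h := internalPart_config_ne_zero (m := m) σ hx P
    have hc : ContDiffAt ℝ ∞ (fun p : ℝ × (Fin d → ℝ) => config m σ p.2) p :=
      ((contDiff_config σ).comp contDiff_snd).contDiffAt
    exact ((contDiff_externalPart P.1).comp hs).contDiffAt.prodMk
      ((contDiffAt_fst.mul (ContDiffAt.comp p (g := internalRadius m P.1)
        (contDiffAt_internalRadius hm h) hc)).prodMk
        (ContDiffAt.comp p (g := unitPart m P.1) (contDiffAt_unitPart hm h) hc))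
  · simp only [diagonalMap_eq]
    have h := hp P hP
    exact ((contDiff_externalPart P.1).comp hs).contDiffAt.prodMk
      ((ContDiffAt.comp p (g := internalRadius m P.1)
        (contDiffAt_internalRadius hm h) hs.contDiffAt).prodMk
        (ContDiffAt.comp p (g := unitPart m P.1) (contDiffAt_unitPart hm h) hs.contDiffAt))

lemma continuousWithinAt_collapse {X : Type*} [TopologicalSpace X] (hm : ∀ i, 0 < m i)
    {t : X → ℝ} {x : X → Fin d → ℝ} {s : Set X} {z : X} (ht : ContinuousWithinAt t s z)
    (hx : ContinuousWithinAt x s z) (ht₀ : 0 ≤ t z) (hx₀ : ∀ k, 0 < x z k) :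
    ContinuousWithinAt (fun z => collapse m σ A (t z) (x z)) s z := by
  have h1 : ContinuousAt (fun p : ℝ × (Fin d → ℝ) => collapse m σ A p.1 p.2) (t z, x z) := by
    refine ContDiffAt.continuousAt (𝕜 := ℝ) (n := ∞) (contDiffAt_collapse σ A hm ?_ ?_)
    · exact hx₀
    · exact fun P hP => internalPart_collapse_ne_zero σ A ht₀ hx₀ hP
  have h2 : Tendsto (fun z => (t z, x z)) (𝓝[s] z) (𝓝 (t z, x z)) := ht.prodMk hx
  have h3 := h1.tendsto.comp h2
  exact h3

lemma position_collapse (hm : ∀ i, 0 < m i) (P₀ : CollisionCluster (d + 1)) (t : ℝ)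
    (x : Fin d → ℝ) : position P₀ (collapse m σ A t x) = config m σ (scaleGaps A t x) := by
  by_cases hP : enclosed σ P₀.1 ⊆ A
  · simp only [position, collapse, if_pos hP]
    rw [mul_smul, internalRadius_smul_unitPart hm, ← internalPart_smul,
      ← internalPart_scaleGaps σ A hm hP, external_add_internal]
  · have h := position_diagonalMap hm P₀ (config m σ (scaleGaps A t x))
    simp only [position, collapse, if_neg hP] at h ⊢
    exact h

lemma collapse_mem (hm : ∀ i, 0 < m i) {t : ℝ} (ht : 0 ≤ t) {x : Fin d → ℝ} (hx : ∀ k, 0 < x k) :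
    collapse m σ A t x ∈ chamberBlowUp m σ := by
  have hpos : ∀ s > 0, collapse m σ A s x ∈ chamberBlowUp m σ := fun s hs => by
    rw [collapse_of_pos σ A hm hs]
    refine diagonalMap_mem_chamberBlowUp σ ((mem_chamber σ).mpr ⟨config_mem σ hm _, ?_⟩)
    rw [gap_config]
    exact scaleGaps_pos A hs hx
  rcases ht.eq_or_lt with rfl | ht
  · have hc := continuousWithinAt_collapse σ A hm (t := fun s : ℝ => s) (x := fun _ => x)
      (s := Set.Ioi 0) (z := 0) continuousWithinAt_id continuousWithinAt_const le_rfl hx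
    have h := mem_closure_of_tendsto (b := 𝓝[>] (0 : ℝ)) hc.tendsto
      (eventually_nhdsWithin_of_forall hpos)
    rwa [chamberBlowUp, closure_closure] at h
  · exact hpos t ht

variable {A}

/-- The open set of points with positive gaps outside `A` and with positive gaps of the direction at
`gapCluster σ A` inside `A`. Its points in the blow-up lie in the closure of the chamber of `σ`
(`mem_chamberBlowUp_of_hasPositiveGaps`). -/
def hasPositiveGaps (hA : A.Nonempty) : Set (Ambient (d + 1) ℝ) :=
  {y | (∀ k ∈ A, 0 < gap σ (y (gapCollision σ hA)).2.2 k) ∧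
    ∀ k ∉ A, 0 < gap σ (position (gapCollision σ hA) y) k}

lemma isOpen_hasPositiveGaps (hA : A.Nonempty) : IsOpen (hasPositiveGaps σ hA) := by
  rw [hasPositiveGaps]
  simp only [Set.ofPred_and, Set.ofPred_forall]
  refine IsOpen.inter (isOpen_iInter_of_finite fun k => isOpen_iInter_of_finite fun _ => ?_)
    (isOpen_iInter_of_finite fun k => isOpen_iInter_of_finite fun _ => ?_)
  · exact isOpen_lt continuous_const (continuous_gap_snd σ _ k)
  · exact isOpen_lt continuous_const ((continuous_apply k).comp (continuous_gap_position σ _))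

lemma diagonalMap_mem_hasPositiveGaps (hm : ∀ i, 0 < m i) (hA : A.Nonempty)
    {q : Fin (d + 1) → ℝ} (hq : Function.Injective q) :
    diagonalMap m q ∈ hasPositiveGaps σ hA ↔ ∀ k, 0 < gap σ q k := by
  have hR := (internalRadius_nonneg (m := m) (gapCluster σ A) q).lt_of_ne'
    (mt (internalRadius_eq_zero hm).mp (internalPart_ne_zero_of_injective hq (gapCollision σ hA)))
  have h1 : ∀ k ∈ A, gap σ (diagonalMap m q (gapCollision σ hA)).2.2 k =
      (internalRadius m (gapCluster σ A) q)⁻¹ * gap σ q k := fun k hk => by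
    simp only [diagonalMap_eq, gapCollision, gap_unitPart_gapCluster σ q hk]
  rw [hasPositiveGaps]
  simp only [Set.mem_ofPred_eq, position_diagonalMap hm]
  refine ⟨fun h k => ?_, fun h => ⟨fun k hk => ?_, fun k _ => h k⟩⟩
  · by_cases hk : k ∈ A
    · have := h.1 k hk
      rw [h1 k hk] at this
      exact pos_of_mul_pos_right this (inv_nonneg.mpr hR.le)
    · exact h.2 k hk
  · rw [h1 k hk]
    exact mul_pos (inv_pos.mpr hR) (h k)

lemma mem_chamberBlowUp_of_hasPositiveGaps (hm : ∀ i, 0 < m i) (hA : A.Nonempty)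
    {y : Ambient (d + 1) ℝ} (hy : y ∈ graphBlowUp m) (hyA : y ∈ hasPositiveGaps σ hA) :
    y ∈ chamberBlowUp m σ := by
  refine closure_mono ?_ ((isOpen_hasPositiveGaps σ hA).inter_closure ⟨hyA, hy⟩)
  rintro _ ⟨h, q, hq, rfl⟩
  have hq' := mem_noncollision.mp hq
  exact ⟨q, (mem_chamber σ).mpr ⟨hq'.1, (diagonalMap_mem_hasPositiveGaps σ hm hA hq'.2).mp h⟩, rfl⟩

open Classical in
/-- The gaps outside `A`, and the direction of the gaps in `A` normalised to have entry `1` at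
`i₀`. -/
def gapDirection (hA : A.Nonempty) (i₀ : Fin d) (y : Ambient (d + 1) ℝ) : Fin d → ℝ := fun k =>
  if k ∈ A then gap σ (y (gapCollision σ hA)).2.2 k / gap σ (y (gapCollision σ hA)).2.2 i₀
  else gap σ (position (gapCollision σ hA) y) k

lemma gapDirection_pos (hA : A.Nonempty) {i₀ : Fin d} (hi : i₀ ∈ A) {y : Ambient (d + 1) ℝ}
    (hy : y ∈ hasPositiveGaps σ hA) (k : Fin d) : 0 < gapDirection σ hA i₀ y k := by
  rw [gapDirection]
  split_ifs with hk
  · exact div_pos (hy.1 k hk) (hy.1 i₀ hi)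
  · exact hy.2 k hk

lemma contDiff_gap_snd (P : CollisionCluster (d + 1)) (k : Fin d) :
    ContDiff ℝ ∞ fun y : Ambient (d + 1) ℝ => gap σ (y P).2.2 k :=
  contDiff_pi.mp ((contDiff_gap σ).comp (by fun_prop : ContDiff ℝ ∞
    fun y : Ambient (d + 1) ℝ => (y P).2.2)) k

lemma contDiff_gap_position (P : CollisionCluster (d + 1)) (k : Fin d) :
    ContDiff ℝ ∞ fun y : Ambient (d + 1) ℝ => gap σ (position P y) k :=
  contDiff_pi.mp ((contDiff_gap σ).comp (contDiff_position P)) k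

lemma contDiffOn_gapDirection (hA : A.Nonempty) {i₀ : Fin d} (hi : i₀ ∈ A) (k : Fin d) :
    ContDiffOn ℝ ∞ (fun y => gapDirection σ hA i₀ y k) (hasPositiveGaps σ hA) := by
  simp only [gapDirection]
  split_ifs with hk
  · exact (contDiff_gap_snd σ _ k).contDiffOn.div (contDiff_gap_snd σ _ i₀).contDiffOn
      fun y hy => (hy.1 i₀ hi).ne'
  · exact (contDiff_gap_position σ _ k).contDiffOn

lemma collapse_gapDirection (hm : ∀ i, 0 < m i) (hA : A.Nonempty) {i₀ : Fin d} (hi : i₀ ∈ A)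
    {y : Ambient (d + 1) ℝ} (hy : y ∈ graphBlowUp m) (hyA : y ∈ hasPositiveGaps σ hA) :
    collapse m σ A (gap σ (position (gapCollision σ hA) y) i₀) (gapDirection σ hA i₀ y) = y := by
  refine Set.EqOn.of_subset_closure (s := diagonalMap m '' chamber m σ)
    (t := chamberBlowUp m σ ∩ hasPositiveGaps σ hA) (f := fun y =>
      collapse m σ A (gap σ (position (gapCollision σ hA) y) i₀) (gapDirection σ hA i₀ y))
    (g := fun y => y) ?_ ?_ continuousOn_id ?_ Set.inter_subset_left
    ⟨mem_chamberBlowUp_of_hasPositiveGaps σ hm hA hy hyA, hyA⟩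
  · rintro _ ⟨q, hq, rfl⟩
    have hgap := ((mem_chamber σ).mp hq).2
    simp only [position_diagonalMap hm]
    rw [collapse_of_pos σ A hm (hgap i₀)]
    have : scaleGaps A (gap σ q i₀) (gapDirection σ hA i₀ (diagonalMap m q)) = gap σ q := by
      ext k
      rw [scaleGaps]
      split_ifs with hk
      · have hR := mt (internalRadius_eq_zero hm).mp (internalPart_ne_zero_of_injective (m := m)
          (injective_of_gap_pos hgap) (gapCollision σ hA))
        simp only [gapCollision] at hR
        have := hgap i₀
        simp only [gapDirection, if_pos hk, diagonalMap_eq, gapCollision,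
          gap_unitPart_gapCluster σ q hk, gap_unitPart_gapCluster σ q hi]
        field_simp
      · simp only [gapDirection, if_neg hk, position_diagonalMap hm]
    rw [this, config_gap σ hm hq.1]
  · intro z ⟨hz, hzA⟩
    have hx := gapDirection_pos σ hA hi hzA
    have ht : ContinuousWithinAt (fun y => gap σ (position (gapCollision σ hA) y) i₀)
        (chamberBlowUp m σ ∩ hasPositiveGaps σ hA) z :=
      (contDiff_gap_position σ _ i₀).continuous.continuousWithinAt
    have hd : ContinuousWithinAt (gapDirection σ hA i₀)
        (chamberBlowUp m σ ∩ hasPositiveGaps σ hA) z :=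
      continuousWithinAt_pi.mpr fun k =>
        ((contDiffOn_gapDirection σ hA hi k).continuousOn z hzA).mono Set.inter_subset_right
    exact continuousWithinAt_collapse σ A hm ht hd (gap_position_nonneg σ hm _ hz i₀) hx
  · rintro _ ⟨q, hq, rfl⟩
    have hgap := ((mem_chamber σ).mp hq).2
    exact ⟨diagonalMap_mem_chamberBlowUp σ hq,
      (diagonalMap_mem_hasPositiveGaps σ hm hA (injective_of_gap_pos hgap)).mpr hgap⟩

lemma gap_snd_collapse (hA : A.Nonempty) (t : ℝ) (x : Fin d → ℝ) {k : Fin d} (hk : k ∈ A) :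
    gap σ (collapse m σ A t x (gapCollision σ hA)).2.2 k =
      (internalRadius m (gapCluster σ A) (config m σ x))⁻¹ * x k := by
  simp only [collapse, gapCollision, enclosed_gapCluster, subset_refl, if_true]
  rw [gap_unitPart_gapCluster σ _ hk, gap_config]

lemma collapse_mem_hasPositiveGaps (hm : ∀ i, 0 < m i) (hA : A.Nonempty) (t : ℝ)
    {x : Fin d → ℝ} (hx : ∀ k, 0 < x k) : collapse m σ A t x ∈ hasPositiveGaps σ hA := by
  refine ⟨fun k hk => ?_, fun k hk => ?_⟩
  · rw [gap_snd_collapse σ hA t x hk]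
    exact mul_pos (inv_pos.mpr ((internalRadius_nonneg _ _).lt_of_ne'
      (mt (internalRadius_eq_zero hm).mp (internalPart_config_ne_zero σ hx (gapCollision σ hA)))))
      (hx k)
  · rw [position_collapse σ A hm, gap_config, scaleGaps, if_neg hk]
    exact hx k

lemma gapDirection_collapse (hm : ∀ i, 0 < m i) (hA : A.Nonempty) {i₀ : Fin d} (hi : i₀ ∈ A)
    (t : ℝ) {x : Fin d → ℝ} (hx : ∀ k, 0 < x k) (hx₀ : x i₀ = 1) :
    gapDirection σ hA i₀ (collapse m σ A t x) = x := by
  ext k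
  rw [gapDirection]
  split_ifs with hk
  · have hR := mt (internalRadius_eq_zero hm).mp
      (internalPart_config_ne_zero (m := m) σ hx (gapCollision σ hA))
    simp only [gapCollision] at hR
    rw [gap_snd_collapse σ hA t x hk, gap_snd_collapse σ hA t x hi, hx₀]
    field_simp
  · rw [position_collapse σ A hm, gap_config, scaleGaps, if_neg hk]

end Collapse

/-! ### Charts at the simplest collisions -/

section Charts

variable {d : ℕ} {m : Fin (d + 2) → ℝ} (σ : Equiv.Perm (Fin (d + 2))) {A : Set (Fin (d + 1))}

lemma swap_eq_iff (i₀ k : Fin (d + 1)) : Equiv.swap 0 i₀ k = i₀ ↔ k = 0 := by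
  rw [← Equiv.eq_symm_apply, Equiv.symm_swap, Equiv.swap_apply_right]

/-- The vector of gaps with the coordinates `z`. The entry at `i₀ ∈ A` is normalised to `1`, and as
the boundary coordinate of a chart comes first, `0` and `i₀` are interchanged in the index. -/
def chartParam (i₀ : Fin (d + 1)) (z : EuclideanSpace ℝ (Fin (d + 1))) : Fin (d + 1) → ℝ :=
  fun i => if i = i₀ then 1 else z (Equiv.swap 0 i₀ i)

lemma chartParam_pos {i₀ : Fin (d + 1)} {z : EuclideanSpace ℝ (Fin (d + 1))}
    (hz : ∀ k, k ≠ 0 → 0 < z k) (i : Fin (d + 1)) : 0 < chartParam i₀ z i := by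
  rw [chartParam]
  split_ifs with h
  · exact one_pos
  · refine hz _ fun h0 => h ?_
    rw [← Equiv.eq_symm_apply, Equiv.symm_swap, Equiv.swap_apply_left] at h0
    exact h0

lemma contDiff_chartParam (i₀ : Fin (d + 1)) : ContDiff ℝ ∞ (chartParam i₀) := by
  refine contDiff_pi.mpr fun k => ?_
  simp only [chartParam]
  split_ifs <;> fun_prop

/-- The chart at points where exactly the gaps in `A` are collapsed. Its boundary coordinate is the
gap `i₀ ∈ A` itself, and its other coordinates are those of `gapDirection`. -/
def collapseChart (hm : ∀ i, 0 < m i) (hA : A.Nonempty) {i₀ : Fin (d + 1)} (hi : i₀ ∈ A) :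
    Corner.Chart (graphBlowUp (E := ℝ) m) (d + 1) where
  k := 1
  k_le := Nat.le_add_left 1 d
  source := graphBlowUp m ∩ hasPositiveGaps σ hA
  target := Corner.model (d + 1) 1 ∩ {z | ∀ k, k ≠ 0 → 0 < z k}
  toFun y := WithLp.toLp 2 fun k => if k = 0 then gap σ (position (gapCollision σ hA) y) i₀ else
    gapDirection σ hA i₀ y (Equiv.swap 0 i₀ k)
  invFun z := collapse m σ A (z 0) (chartParam i₀ z)
  source_open := ⟨_, isOpen_hasPositiveGaps σ hA, rfl⟩
  target_open := by
    refine ⟨_, ?_, rfl⟩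
    simp only [Set.ofPred_forall]
    exact isOpen_iInter_of_finite fun k => isOpen_iInter_of_finite fun _ =>
      isOpen_lt continuous_const (by fun_prop)
  mapsTo := by
    rintro y ⟨hy, hyA⟩
    refine ⟨fun k hk => ?_, fun k hk => ?_⟩
    · have hk0 : k = 0 := Fin.ext (by simpa using hk)
      simp only [hk0, if_true]
      exact gap_position_nonneg σ hm _ (mem_chamberBlowUp_of_hasPositiveGaps σ hm hA hy hyA) _
    · simp only [hk, if_false]
      exact gapDirection_pos σ hA hi hyA _
  mapsTo_inv := by
    rintro z ⟨hz, hz'⟩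
    exact ⟨chamberBlowUp_subset σ (collapse_mem σ A hm (hz 0 (by simp)) (chartParam_pos hz')),
      collapse_mem_hasPositiveGaps σ hm hA _ (chartParam_pos hz')⟩
  leftInv := by
    rintro y ⟨hy, hyA⟩
    have : chartParam i₀ (WithLp.toLp 2 fun k => if k = 0 then
        gap σ (position (gapCollision σ hA) y) i₀ else
        gapDirection σ hA i₀ y (Equiv.swap 0 i₀ k)) = gapDirection σ hA i₀ y := by
      ext i
      rw [chartParam]
      split_ifs with h
      · rw [h, gapDirection, if_pos hi, div_self (hyA.1 i₀ hi).ne']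
      · have h0 : Equiv.swap 0 i₀ i ≠ 0 := fun h0 => h (by
          rw [← Equiv.eq_symm_apply, Equiv.symm_swap, Equiv.swap_apply_left] at h0
          exact h0)
        simp only [h0, if_false, Equiv.swap_apply_self]
    simp only [this, if_true]
    exact collapse_gapDirection σ hm hA hi hy hyA
  rightInv := by
    rintro z ⟨hz, hz'⟩
    ext k
    have hx := chartParam_pos (i₀ := i₀) hz'
    have h1 : chartParam i₀ z i₀ = 1 := by simp [chartParam]
    simp only [gapDirection_collapse σ hm hA hi _ hx h1]
    split_ifs with hk
    · rw [position_collapse σ A hm, gap_config, scaleGaps, if_pos hi, h1, mul_one, hk]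
    · rw [chartParam, if_neg (mt (swap_eq_iff i₀ k).mp hk), Equiv.swap_apply_self]
  smooth := by
    refine ⟨_, _, isOpen_hasPositiveGaps σ hA, Set.inter_subset_right, ?_, fun _ _ => rfl⟩
    refine contDiffOn_euclidean.mpr fun k => ?_
    simp only
    split_ifs with hk
    · exact (contDiff_gap_position σ _ i₀).contDiffOn
    · exact contDiffOn_gapDirection σ hA hi _
  smooth_inv := by
    have hc : ContDiff ℝ ∞ fun z : EuclideanSpace ℝ (Fin (d + 1)) => (z 0, chartParam i₀ z) :=
      ContDiff.prodMk (by fun_prop) (contDiff_chartParam i₀)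
    refine ⟨{z | (∀ k, k ≠ 0 → 0 < z k) ∧ ∀ P : CollisionCluster (d + 2),
      ¬ enclosed σ P.1 ⊆ A → internalPart m P.1 (config m σ (scaleGaps A (z 0) (chartParam i₀ z))) ≠
        0},
      _, ?_, ?_, ?_, fun _ _ => rfl⟩
    · simp only [Set.ofPred_and, Set.ofPred_forall]
      refine IsOpen.inter (isOpen_iInter_of_finite fun k => isOpen_iInter_of_finite fun _ =>
        isOpen_lt continuous_const (by fun_prop)) (isOpen_iInter_of_finite fun P =>
          isOpen_iInter_of_finite fun _ => ?_)
      exact isOpen_ne_fun ((contDiff_internalPart P.1).continuous.comp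
        ((contDiff_config σ).continuous.comp ((contDiff_scaleGaps A).continuous.comp
          hc.continuous))) continuous_const
    · rintro z ⟨hz, hz'⟩
      exact ⟨hz', fun P hP => internalPart_collapse_ne_zero σ A (hz 0 (by simp))
        (chartParam_pos hz') hP⟩
    · rintro z ⟨hz', hz⟩
      exact ((contDiffAt_collapse σ A hm (p := (z 0, chartParam i₀ z)) (chartParam_pos hz')
        hz).comp z hc.contDiffAt).contDiffWithinAt

lemma collapse_zero_mem_stratum (hm : ∀ i, 0 < m i) (hA : A.Nonempty) {x : Fin (d + 1) → ℝ}
    (hx : ∀ k, 0 < x k) :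
    collapse m σ A 0 x ∈ Corner.stratum (graphBlowUp (E := ℝ) m) (d + 1) 1 := by
  obtain ⟨i₀, hi⟩ := hA
  refine ⟨collapseChart σ hm ⟨i₀, hi⟩ hi, ⟨chamberBlowUp_subset σ
    (collapse_mem σ A hm le_rfl hx), collapse_mem_hasPositiveGaps σ hm _ 0 hx⟩, ?_⟩
  rw [Set.ncard_eq_one]
  refine ⟨0, Set.ext fun k => ⟨fun h => Fin.ext (by simpa [collapseChart] using h.1), ?_⟩⟩
  rintro rfl
  refine ⟨by simp [collapseChart], ?_⟩
  simp only [collapseChart, if_true]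
  rw [position_collapse σ A hm, gap_config, scaleGaps, if_pos hi, zero_mul]

end Charts

end NBody

namespace NBody

open Filter Topology RatioSpace

/-! ### The boundary inside a chamber closure -/

section Boundary

variable {d : ℕ} {m : Fin (d + 2) → ℝ} (σ : Equiv.Perm (Fin (d + 2)))

lemma stratum_subset {V : Type*} [NormedAddCommGroup V] [NormedSpace ℝ V] {X : Set V} {d l : ℕ} :
    Corner.stratum X d l ⊆ X := by
  rintro p ⟨c, hp, -⟩
  obtain ⟨O, -, hO⟩ := c.source_open
  rw [hO] at hp
  exact hp.1

/-- If a sequence `q N` in the chamber tends to `y`, and `A` is the set of vanishing gaps at `y`,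
then the points that result from collapsing the gaps in `A` of `q N` tend to `y`, too. -/
lemma chamberBoundary_subset_closure (hm : ∀ i, 0 < m i) (P₀ : CollisionCluster (d + 2)) :
    chamberBoundary m σ P₀ ⊆ closure (Corner.stratum (graphBlowUp (E := ℝ) m) (d + 1) 1) := by
  rintro y ⟨hy, k₀, hk₀⟩
  obtain ⟨hposmem, hprops⟩ := graphBlowUp_props hm P₀ (chamberBlowUp_subset σ hy)
  set A : Set (Fin (d + 1)) := {k | gap σ (position P₀ y) k = 0} with hA
  obtain ⟨u, hu, hlim⟩ := mem_closure_iff_seq_limit.mp hy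
  choose q hq hqu using hu
  have hgap : ∀ N k, 0 < gap σ (q N) k := fun N => ((mem_chamber σ).mp (hq N)).2
  have hqlim : Tendsto q atTop (𝓝 (position P₀ y)) := by
    have := ((contDiff_position P₀).continuous.tendsto y).comp hlim
    refine this.congr fun N => ?_
    rw [Function.comp_apply, ← hqu, position_diagonalMap hm]
  have hc : Continuous fun q : Fin (d + 2) → ℝ => config m σ (scaleGaps A 0 (gap σ q)) :=
    (contDiff_config σ).continuous.comp ((contDiff_scaleGaps A).continuous.comp
      (continuous_const.prodMk (contDiff_gap σ).continuous))
  have hfix : config m σ (scaleGaps A 0 (gap σ (position P₀ y))) = position P₀ y := by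
    have : scaleGaps A 0 (gap σ (position P₀ y)) = gap σ (position P₀ y) := by
      ext k
      rw [scaleGaps]
      split_ifs with hk
      · rw [zero_mul]; exact hk.symm
      · rfl
    rw [this, config_gap σ hm hposmem]
  have hslim : Tendsto (fun N => config m σ (scaleGaps A 0 (gap σ (q N)))) atTop
      (𝓝 (position P₀ y)) := by
    have := (hc.tendsto (position P₀ y)).comp hqlim
    rwa [hfix] at this
  refine mem_closure_of_tendsto (f := fun N => collapse m σ A 0 (gap σ (q N))) (b := atTop) ?_
    (Eventually.of_forall fun N => collapse_zero_mem_stratum σ hm ⟨k₀, hk₀⟩ (hgap N))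
  refine tendsto_pi_nhds.mpr fun P => ?_
  obtain ⟨h1, h2, h3, -, -⟩ := hprops P
  have e1 := ((contDiff_externalPart (m := m) P.1).continuous.tendsto (position P₀ y)).comp hslim
  rw [← h1] at e1
  by_cases hP : enclosed σ P.1 ⊆ A
  · have hint : internalPart m P.1 (position P₀ y) = 0 :=
      internalPart_eq_zero_of_gap σ hm fun k hk => hP hk
    have e2 : (y P).2.1 = 0 := by rw [h2, internalRadius_eq_zero hm, hint]
    have e3 : Tendsto (fun N => unitPart m P.1 (q N)) atTop (𝓝 (y P).2.2) := by
      have hcs : Continuous fun y : Ambient (d + 2) ℝ => (y P).2.2 := by fun_prop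
      exact ((hcs.tendsto y).comp hlim).congr fun N => by
        rw [Function.comp_apply, ← hqu, diagonalMap_eq]
    simp only [collapse, if_pos hP, config_gap σ hm (hq _).1, zero_mul]
    refine e1.prodMk_nhds (Tendsto.prodMk_nhds ?_ e3)
    rw [e2]
    exact tendsto_const_nhds
  · have hint : internalPart m P.1 (position P₀ y) ≠ 0 :=
      internalPart_ne_zero_of_not_subset σ A (gap_position_nonneg σ hm P₀ hy) (fun k hk =>
        (gap_position_nonneg σ hm P₀ hy k).lt_of_ne' hk) hP
    have hr : (y P).2.1 ≠ 0 := by rw [h2]; exact mt (internalRadius_eq_zero hm).mp hint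
    have e2 := ((continuous_internalRadius (m := m) P.1).tendsto (position P₀ y)).comp hslim
    have e3 := (contDiffAt_unitPart hm hint).continuousAt.tendsto.comp hslim
    have e4 : unitPart m P.1 (position P₀ y) = (y P).2.2 := by
      rw [unitPart, ← h3, ← h2, smul_smul, inv_mul_cancel₀ hr, one_smul]
    rw [← h2] at e2
    rw [e4] at e3
    simp only [collapse, if_neg hP, diagonalMap_eq]
    exact e1.prodMk_nhds (e2.prodMk_nhds e3)

theorem boundary_inter_chamberBlowUp (hm : ∀ i, 0 < m i) (P₀ : CollisionCluster (d + 2)) :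
    Corner.boundary (graphBlowUp (E := ℝ) m) (d + 1) ∩ chamberBlowUp m σ =
      chamberBoundary m σ P₀ := by
  refine Set.Subset.antisymm ?_ fun y hy =>
    ⟨⟨chamberBlowUp_subset σ hy.1, chamberBoundary_subset_closure σ hm P₀ hy⟩, hy.1⟩
  rintro y ⟨⟨-, hcl⟩, hy⟩
  refine ⟨hy, ?_⟩
  by_contra! hne
  have hO : IsOpen {y : Ambient (d + 2) ℝ | ∀ k, 0 < gap σ (position P₀ y) k} := by
    simp only [Set.ofPred_forall]
    exact isOpen_iInter_of_finite fun k => isOpen_lt continuous_const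
      ((continuous_apply k).comp (continuous_gap_position σ P₀))
  obtain ⟨z, hz, hzs⟩ := mem_closure_iff.mp hcl _ hO fun k =>
    (gap_position_nonneg σ hm P₀ hy k).lt_of_ne' (hne k)
  have hzX := stratum_subset hzs
  rw [eq_diagonalMap_of_injective hm P₀ hzX (injective_of_gap_pos hz)] at hzs
  exact diagonalMap_notMem_stratum σ hm
    ((mem_chamber σ).mpr ⟨(graphBlowUp_props hm P₀ hzX).1, hz⟩) hzs

end Boundary

/-! ### The blow-up as disjoint union of chamber closures -/

section Chambers

variable {d : ℕ} {m : Fin (d + 1) → ℝ}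

lemma graphBlowUp_eq_iUnion (m : Fin (d + 1) → ℝ) :
    graphBlowUp (E := ℝ) m = ⋃ σ, chamberBlowUp m σ := by
  have : noncollision (E := ℝ) m = ⋃ σ, chamber m σ := by
    refine Set.Subset.antisymm (fun q hq => ?_)
      (Set.iUnion_subset fun σ => chamber_subset_noncollision σ)
    obtain ⟨hqM, hinj⟩ := mem_noncollision.mp hq
    exact Set.mem_iUnion.mpr ⟨Tuple.sort q, hqM,
      (Tuple.monotone_sort q).strictMono_of_injective (hinj.comp (Tuple.sort q).injective)⟩
  rw [graphBlowUp, this, Set.image_iUnion, closure_iUnion_of_finite]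
  rfl

lemma snd_le_of_mem_chamberBlowUp (σ : Equiv.Perm (Fin (d + 1))) {y : Ambient (d + 1) ℝ}
    (hy : y ∈ chamberBlowUp m σ) (P : CollisionCluster (d + 1)) {i j : Fin (d + 1)}
    (hij : σ.symm i ≤ σ.symm j) (hP : P.1.part i = P.1.part j) : (y P).2.2 i ≤ (y P).2.2 j := by
  have hcl : IsClosed {y : Ambient (d + 1) ℝ | (y P).2.2 i ≤ (y P).2.2 j} :=
    isClosed_le (by fun_prop) (by fun_prop)
  refine closure_minimal ?_ hcl hy
  rintro _ ⟨q, hq, rfl⟩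
  have h1 : q i ≤ q j := by simpa using hq.2.monotone hij
  simp only [Set.mem_ofPred_eq, diagonalMap_eq, unitPart, internalPart, Pi.smul_apply,
    Pi.sub_apply, smul_eq_mul, externalPart_const P.1 q hP]
  exact mul_le_mul_of_nonneg_left (by linarith) (inv_nonneg.mpr (internalRadius_nonneg _ _))

/-- The direction at the decomposition joining two neighbours remembers their order. -/
theorem eq_of_mem_chamberBlowUp (hm : ∀ i, 0 < m i) {σ τ : Equiv.Perm (Fin (d + 1))}
    {y : Ambient (d + 1) ℝ} (hσ : y ∈ chamberBlowUp m σ) (hτ : y ∈ chamberBlowUp m τ) :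
    σ = τ := by
  have hmono : StrictMono fun i => τ.symm (σ i) := by
    refine Fin.strictMono_iff_lt_succ.mpr fun k => ?_
    by_contra! hle
    obtain ⟨l, hl, hpos⟩ := exists_gap_snd_pos σ hm (Set.singleton_nonempty k) hσ
    rw [Set.mem_singleton_iff.mp hl, gap_apply] at hpos
    have := snd_le_of_mem_chamberBlowUp τ hτ (gapCollision σ (Set.singleton_nonempty k)) hle
      (gapCluster_part_succ σ (Set.mem_singleton k)).symm
    linarith
  have h := (hmono.range_inj strictMono_id).mp (by
    rw [Set.range_id, Set.range_eq_univ]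
    exact τ.symm.surjective.comp σ.surjective)
  ext i
  have := congrFun h i
  simp only [id] at this
  rw [Equiv.symm_apply_eq] at this
  rw [this]

end Chambers

end NBody

end

/-! ### The boundary of the blow-up -/

theorem corollary5p4 (n : ℕ) (hn : 2 ≤ n) (m : Fin n → ℝ) (hm : ∀ i, 0 < m i) :
    ∃ (e : Fin (n !) ≃ Equiv.Perm (Fin n))
      (h : Corner.boundary (NBody.graphBlowUp (E := ℝ) m) (n - 1) ≃ₜ
        (_ : Fin (n !)) × EuclideanSpace ℝ (Fin (n - 2))),
      ∀ (a : Fin (n !)) (p : Corner.boundary (NBody.graphBlowUp (E := ℝ) m) (n - 1)),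
        (h p).1 = a ↔
          (p : NBody.Ambient n ℝ) ∈
            closure (NBody.diagonalMap m '' NBody.chamber m (e a)) := by
  obtain ⟨d, rfl⟩ := Nat.exists_eq_add_of_le' hn
  change ∃ (e : Fin ((d + 2)!) ≃ Equiv.Perm (Fin (d + 2)))
      (h : Corner.boundary (NBody.graphBlowUp (E := ℝ) m) (d + 1) ≃ₜ
        (_ : Fin ((d + 2)!)) × EuclideanSpace ℝ (Fin d)),
      ∀ (a : Fin ((d + 2)!)) (p : Corner.boundary (NBody.graphBlowUp (E := ℝ) m) (d + 1)),
        (h p).1 = a ↔ (p : NBody.Ambient (d + 2) ℝ) ∈ NBody.chamberBlowUp m (e a)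
  have e : Fin ((d + 2)!) ≃ Equiv.Perm (Fin (d + 2)) := Fintype.equivOfCardEq (by
    rw [Fintype.card_fin, Fintype.card_perm, Fintype.card_fin])
  set P₀ : NBody.CollisionCluster (d + 2) := NBody.gapCollision 1 (Set.singleton_nonempty 0)
  have hB := fun a => NBody.boundary_inter_chamberBlowUp (e a) hm P₀
  set B := Corner.boundary (NBody.graphBlowUp (E := ℝ) m) (d + 1)
  -- The finitely many closed pieces `chamberBoundary m (e a) P₀` form a partition of the boundary.
  let f : ((a : Fin ((d + 2)!)) × NBody.chamberBoundary m (e a) P₀) → B :=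
    fun x => ⟨x.2, ((hB x.1).ge x.2.2).1⟩
  have hf : Function.Bijective f := by
    refine ⟨fun ⟨a, y⟩ ⟨b, z⟩ h => ?_, fun ⟨y, hy⟩ => ?_⟩
    · have hyz : (y : NBody.Ambient (d + 2) ℝ) = z := congrArg Subtype.val h
      obtain rfl : a = b := e.injective
        (NBody.eq_of_mem_chamberBlowUp hm y.2.1 (by rw [hyz]; exact z.2.1))
      rw [Subtype.ext hyz]
    · have hyX : y ∈ NBody.graphBlowUp (E := ℝ) m := hy.1
      rw [NBody.graphBlowUp_eq_iUnion] at hyX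
      obtain ⟨σ, hσ⟩ := Set.mem_iUnion.mp hyX
      obtain ⟨a, rfl⟩ := e.surjective σ
      exact ⟨⟨a, y, (hB a).le ⟨hy, hσ⟩⟩, rfl⟩
  have hfc : Continuous f := continuous_sigma fun a => continuous_subtype_val.subtype_mk _
  have hfcl : IsClosedMap f := by
    intro S hS
    have : f '' S = ⋃ a, (fun y : NBody.chamberBoundary m (e a) P₀ => f ⟨a, y⟩) ''
        {y | ⟨a, y⟩ ∈ S} := by
      ext z
      simp only [Set.mem_image, Set.mem_iUnion, Sigma.exists]
      rfl
    rw [this]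
    refine isClosed_iUnion_of_finite fun a => ?_
    have hT : IsClosed (Subtype.val '' {y : NBody.chamberBoundary m (e a) P₀ | ⟨a, y⟩ ∈ S}) :=
      (NBody.isClosed_chamberBoundary (e a) P₀).isClosedMap_subtype_val _
        (hS.preimage continuous_sigmaMk)
    convert hT.preimage continuous_subtype_val using 1
    ext z
    exact ⟨fun ⟨y, hy, hz⟩ => ⟨y, hy, congrArg Subtype.val hz⟩,
      fun ⟨y, hy, hz⟩ => ⟨y, hy, Subtype.ext hz⟩⟩
  let F := (Equiv.ofBijective f hf).toHomeomorphOfContinuousClosed hfc hfcl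
  let G : ((a : Fin ((d + 2)!)) × NBody.chamberBoundary m (e a) P₀) ≃ₜ
      ((_ : Fin ((d + 2)!)) × EuclideanSpace ℝ (Fin d)) :=
    { (Equiv.sigmaCongrRight fun a => (NBody.chamberBoundaryHomeomorph (e a) hm P₀).toEquiv) with
      continuous_toFun := continuous_sigma fun a => continuous_sigmaMk.comp
        (NBody.chamberBoundaryHomeomorph (e a) hm P₀).continuous
      continuous_invFun := continuous_sigma fun a => continuous_sigmaMk.comp
        (NBody.chamberBoundaryHomeomorph (e a) hm P₀).symm.continuous }
  refine ⟨e, F.symm.trans G, fun a p => ?_⟩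
  obtain ⟨⟨b, y⟩, rfl⟩ := F.surjective p
  have h1 : ((F.symm.trans G) (F ⟨b, y⟩)).1 = b := by
    rw [Homeomorph.trans_apply, Homeomorph.symm_apply_apply]
    rfl
  rw [h1]
  refine ⟨?_, fun h => e.injective (NBody.eq_of_mem_chamberBlowUp hm y.2.1 h)⟩
  rintro rfl
  exact y.2.1
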